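/- Let $e\neq 0$ be the coupling constant, $a>0$, and let $0\neq m\in\mathbb Z$. Consider the canonical variables $(\vec A_i,\vec\pi^i,\vec\phi,\vec\Pi)$ of $\mathrm{SU}(2)$ Yang--Mills--Higgs theory on $\mathbb R^3$: smooth fields with values in $\mathfrak{su}(2)\cong(\mathbb R^3,\times)$. Write $r=\|x\|$, let $\bar a$ be an index on the unit sphere $S^2$, and let $o(r^{-\mathbb N})$ denote terms that are $o(r^{-n})$ for all $n$, uniformly in the direction. Assume the fall-off and boundary conditions $$\vec A_r=(r^{-1}\bar A_r+r^{-2}A_r^{(1)}+\dots)\vec\phi_\infty+o(r^{-\mathbb N}),\qquad \vec\pi^r=(\bar\pi^r+r^{-1}\pi^r_{(1)}+\dots)\vec\phi_\infty+o(r^{-\mathbb N}),$$ $$\vec A_{\bar a}=-\tfrac1{ea^2}\,\vec\phi_\infty\times\partial_{\bar a}\vec\phi_\infty+(\bar A_{\bar a}+r^{-1}A^{(1)}_{\bar a}+\dots)\vec\phi_\infty+o(r^{-\mathbb N}),\qquad \vec\pi^{\bar a}=(r^{-1}\bar\pi^{\bar a}+r^{-2}\pi^{\bar a}_{(1)}+\dots)\vec\phi_\infty+o(r^{-\mathbb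 N}),$$ $$\vec\phi=\vec\phi_\infty+o(r^{-\mathbb N}),\qquad \vec\Pi=o(r^{-\mathbb N}),\qquad \|\vec\phi_\infty\|=a,\qquad \partial_{\bar a}\bar\pi^{\bar a}=0,$$ with smooth coefficients on $S^2$; the last equation is the leading order of the Gauss law. Here $\vec\pi$ is a density, with the factor $\sqrt{\det\bar\gamma}$ of the round metric $\bar\gamma$ of $S^2$ in spherical coordinates. Let $\mathrm{Vol}_{\phi}=\vec\phi\cdot(\partial_{\bar a}\vec\phi\times\partial_{\bar b}\vec\phi)$, a two-form on $S^2$, and let $\mathcal F^{(m)}$ be the set of smooth maps $\vec\phi:S^2\to\{\|v\|=a\}$ of degree $\frac1{4\pi a^3}\oint\mathrm{Vol}_\phi=m$. Tensor fields on $S^2$ are called even or odd if their Cartesian components in $\mathbb R^3$ are even or odd under $x\mapsto -x$. (So a two-form is odd iff its pull-back under $x\mapsto -x$ is its negative.) (i) For all $\vec\phi_\infty,\vec\phi_\infty'\in\mathcal F^{(m)}$ there is a smooth one-form $A^{\rm gau}$ on $S^2$ with $dA^{\rm gau}=(ea^4)^{-1}(\mathrm{Vol}_{\phi_\infty}-\mathrm{Vol}_{\phi'_\infty})$.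 (ii) Consider the set of canonical variables as above that satisfy in addition the parity conditions: $\vec\phi_\infty\in\mathcal F^{(m)}$; $\bar A_r$ is odd and $\bar\pi^r$ is even; $\bar\pi^{\bar a}$ is odd; and $$\bar A_{\bar a}=\bar A^{\rm even}_{\bar a}+\partial_{\bar a}\Phi_{\rm even}+A^{\rm gau}_{\bar a}$$ for some smooth even one-form $\bar A^{\rm even}_{\bar a}$, some smooth even function $\Phi_{\rm even}$ and some smooth one-form $A^{\rm gau}$ with $dA^{\rm gau}=(ea^4)^{-1}(\mathrm{Vol}_{\phi_\infty}-\mathrm{Vol}_{\phi'_\infty})$, where $\vec\phi'_\infty\in\mathcal F^{(m)}$ is some map such that $\mathrm{Vol}_{\phi'_\infty}$ is odd. Let $s\mapsto(\vec A(s),\vec\pi(s),\vec\phi(s),\vec\Pi(s))$ be a smooth curve in this set, along which the coefficients of the expansions depend smoothly on $s$ and the expansions may be differentiated term by term in $s$. Then the symplectic potential at the point $s=0$, evaluated on the tangent vector of the curve, $$\Theta=\int d^3x\,\vec\pi^i\cdot\partial_s\vec A_i+\int d^3x\,\vec\Pi\cdot\partial_s\vec\phi,$$ is finite: the second integral converges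 absolutely, and the first, whose integrand is only $O(r^{-3})$, exists as the limit of the integrals over the balls $\{\|x\|<R\}$ as $R\to\infty$. -/

import Mathlib

open MeasureTheory Filter Topology
open scoped ContDiff

noncomputable section

/-- Euclidean three-space. It serves both as space and as the Lie algebra `su(2) ≅ (ℝ³, ×)`. -/
abbrev E3 : Type := EuclideanSpace ℝ (Fin 3)

/-- The unit sphere in `E3`. -/
abbrev S2 : Type := Metric.sphere (0 : E3) 1

/-- The standard basis vectors of `E3`. -/
def basisVec (j : Fin 3) : E3 := EuclideanSpace.single j 1

/-- The vector product on `E3`. -/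
def cross (u v : E3) : E3 := WithLp.toLp 2 (crossProduct u.ofLp v.ofLp)

/-- The direction `x / ‖x‖` of a nonzero vector (an arbitrary direction if `x = 0`). -/
def dir (x : E3) : S2 :=
  if h : x = 0 then ⟨EuclideanSpace.single 0 1, by simp⟩
  else ⟨‖x‖⁻¹ • x, by simp [norm_smul, h]⟩

/-! ### Calculus on the unit sphere

A function on the sphere is differentiated through its radially constant extension to `ℝ³ ∖ {0}`.
One-forms and vector fields on the sphere are given by their Cartesian components, that is, by
maps `α : S2 → E3` with `α x` orthogonal to `x`. -/

section Sphere

variable {F : Type*} [NormedAddCommGroup F] [NormedSpace ℝ F]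

/-- Smooth functions on the sphere: the radially constant extension is smooth on `ℝ³ ∖ {0}`. -/
def SmoothS2 (f : S2 → F) : Prop :=
  ContDiffOn ℝ ∞ (fun y : E3 => f (dir y)) {0}ᶜ

/-- Families of functions on the sphere that are jointly smooth in the parameter and the point. -/
def SmoothFamilyS2 (f : ℝ → S2 → F) : Prop :=
  ContDiffOn ℝ ∞ (fun p : ℝ × E3 => f p.1 (dir p.2)) (Set.univ ×ˢ {0}ᶜ)

/-- The derivative of `f` at `x` along the tangential part of `u`. -/
def sphereDeriv (f : S2 → F) (x : S2) (u : E3) : F :=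
  fderiv ℝ (fun y : E3 => f (dir y)) (x : E3) u

end Sphere

/-- The tangent plane of the sphere at `x`. -/
def IsTangentAt (x : S2) (u : E3) : Prop := inner ℝ (x : E3) u = 0

/-- Smooth tangential fields: smooth one-forms, or smooth vector fields, on the sphere. -/
def IsTangentField (α : S2 → E3) : Prop := SmoothS2 α ∧ ∀ x, IsTangentAt x (α x)

/-- The differential of a function on the sphere, by Cartesian components. -/
def sphereGrad (f : S2 → ℝ) (x : S2) : E3 :=
  WithLp.toLp 2 (fun j => sphereDeriv f x (basisVec j))

/-- The divergence of a tangential vector field on the sphere. -/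
def sphereDiv (X : S2 → E3) (x : S2) : ℝ :=
  ∑ j, (sphereDeriv X x (basisVec j)) j

/-- The exterior derivative `(dα)(u, w)` of a one-form on the sphere, for `u`, `w` tangent
at `x`. -/
def sphereExtDeriv (α : S2 → E3) (x : S2) (u w : E3) : ℝ :=
  inner ℝ (sphereDeriv α x u) w - inner ℝ (sphereDeriv α x w) u

/-- The two-form `Vol_φ(u, w) = φ · (∂_u φ × ∂_w φ)` on the sphere. -/
def volForm (φ : S2 → E3) (x : S2) (u w : E3) : ℝ :=
  inner ℝ (φ x) (cross (sphereDeriv φ x u) (sphereDeriv φ x w))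

/-- The density of `Vol_φ` with respect to the area form of the unit sphere that is oriented by
the outward normal. -/
def volDensity (φ : S2 → E3) (x : S2) : ℝ :=
  ∑ i : Fin 3, (x : E3) i * volForm φ x (basisVec (i + 1)) (basisVec (i + 2))

/-- The magnetic charge of a map to the sphere of radius `a`: its degree, as the integral of the
pull-back of the normalized volume form. -/
def magneticCharge (a : ℝ) (φ : S2 → E3) : ℝ :=
  (4 * Real.pi * a ^ 3)⁻¹ * ∫ x : S2, volDensity φ x ∂((volume : Measure E3).toSphere)

/-- Higgs vacua of magnetic charge `m`: smooth maps from the sphere to the sphere of radius `a`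
of degree `m`. -/
structure IsVacuum (a : ℝ) (m : ℤ) (φ : S2 → E3) : Prop where
  smooth : SmoothS2 φ
  norm_eq : ∀ x, ‖φ x‖ = a
  charge_eq : magneticCharge a φ = m

/-- The two-form `Vol_φ` is odd under the antipodal map `x ↦ -x`. -/
def VolOdd (φ : S2 → E3) : Prop :=
  ∀ x u w, IsTangentAt x u → IsTangentAt x w →
    volForm φ (-x) (-u) (-w) = - volForm φ x u w

/-- The equation `dα = (e a⁴)⁻¹ (Vol_φ - Vol_φ')` of two-forms on the sphere. -/
def IsGaugeForm (e a : ℝ) (φ φ' α : S2 → E3) : Prop :=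
  ∀ x u w, IsTangentAt x u → IsTangentAt x w →
    sphereExtDeriv α x u w = (e * a ^ 4)⁻¹ * (volForm φ x u w - volForm φ' x u w)

/-! ### Canonical variables and their asymptotics -/

/-- The canonical variables in Cartesian components: the Yang-Mills field `A i`, its momentum
`mom i`, the Higgs field `phi` and its momentum `phiMom`. -/
structure Fields where
  A : Fin 3 → E3 → E3
  mom : Fin 3 → E3 → E3
  phi : E3 → E3
  phiMom : E3 → E3

/-- The coefficients of the asymptotic expansions: the Higgs vacuum `phiInf`, and at each order
the radial and the angular parts of the Yang-Mills field and of its momentum along `phiInf`.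
The momentum is a density; its coefficients are taken with respect to the area density of the unit
sphere. -/
structure AsymptoticData where
  phiInf : S2 → E3
  Ar : ℕ → S2 → ℝ
  Aang : ℕ → S2 → E3
  momr : ℕ → S2 → ℝ
  momang : ℕ → S2 → E3

/-- The radial component `n^i B_i` with `n = x / ‖x‖`. -/
def radialPart (B : Fin 3 → E3 → E3) (x : E3) : E3 :=
  ∑ i, (dir x : E3) i • B i x

/-- The Cartesian components of the angular part of `B`. -/
def angularPart (B : Fin 3 → E3 → E3) (j : Fin 3) (x : E3) : E3 :=
  B j x - (dir x : E3) j • radialPart B x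

/-- The asymptotic expansion `f ∼ ∑ r⁻ⁿ c_n(x / r)` as `r = ‖x‖ → ∞`, uniformly in the
direction. -/
def HasExpansion (f : E3 → E3) (c : ℕ → S2 → E3) : Prop :=
  ∀ N : ℕ, (fun x : E3 => f x - ∑ n ∈ Finset.range (N + 1), (‖x‖⁻¹ ^ n) • c n (dir x))
    =o[cocompact E3] (fun x : E3 => ‖x‖⁻¹ ^ N)

/-- At each parameter value the family has an asymptotic expansion, which may be differentiated
term by term with respect to the parameter. -/
def HasExpansionFamily (f : ℝ → E3 → E3) (c : ℝ → ℕ → S2 → E3) : Prop :=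
  ∀ s, HasExpansion (f s) (c s) ∧
    HasExpansion (fun x => deriv (fun t => f t x) s) (fun n y => deriv (fun t => c t n y) s)

/-- Coefficients of `r A_r = (Ā_r + r⁻¹ A_r⁽¹⁾ + …) φ∞ + o(r^{-ℕ})`. -/
def coeffAr (d : AsymptoticData) (n : ℕ) (y : S2) : E3 := d.Ar n y • d.phiInf y

/-- Coefficients of the angular part of the Yang-Mills field: the leading one is
`-(e a²)⁻¹ φ∞ × ∂_j φ∞ + Ā_j φ∞`, the others are parallel to `φ∞`. Since
`A_ā = A_i ∂x^i/∂x^ā = r A_i ∂n^i/∂x^ā`, these are the coefficients of `r` times `angularPart`. -/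
def coeffAang (e a : ℝ) (d : AsymptoticData) (j : Fin 3) (n : ℕ) (y : S2) : E3 :=
  (if n = 0 then
    -((e * a ^ 2)⁻¹ • cross (d.phiInf y) (sphereDeriv d.phiInf y (basisVec j)))
   else 0) + (d.Aang n y) j • d.phiInf y

/-- Coefficients of `r² n_i π^i = (π̄^r + r⁻¹ π^r₍₁₎ + …) φ∞ + o(r^{-ℕ})`. -/
def coeffMomr (d : AsymptoticData) (n : ℕ) (y : S2) : E3 := d.momr n y • d.phiInf y

/-- Coefficients of the angular part of `r² π^i`. -/
def coeffMomang (d : AsymptoticData) (j : Fin 3) (n : ℕ) (y : S2) : E3 :=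
  (d.momang n y) j • d.phiInf y

/-- Coefficients of `φ = φ∞ + o(r^{-ℕ})`. -/
def coeffPhi (d : AsymptoticData) (n : ℕ) (y : S2) : E3 := if n = 0 then d.phiInf y else 0

/-- A smooth curve in the space of canonical variables that obey the fall-off and boundary
conditions, together with the coefficients of the expansions along the curve. The Cartesian
expansions below are those in spherical coordinates, since `A_ā = A_i ∂x^i/∂x^ā` and, for the
density `π`, `π^r = r² √γ̄ n_i π^i` and `π^ā = r² √γ̄ (∂x^ā/∂x^i) π^i`. -/
structure IsProtoCurve (e a : ℝ) (γ : ℝ → Fields) (d : ℝ → AsymptoticData) : Prop where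
  smooth_A : ∀ i, ContDiff ℝ ∞ (fun p : ℝ × E3 => (γ p.1).A i p.2)
  smooth_mom : ∀ i, ContDiff ℝ ∞ (fun p : ℝ × E3 => (γ p.1).mom i p.2)
  smooth_phi : ContDiff ℝ ∞ (fun p : ℝ × E3 => (γ p.1).phi p.2)
  smooth_phiMom : ContDiff ℝ ∞ (fun p : ℝ × E3 => (γ p.1).phiMom p.2)
  smooth_phiInf : SmoothFamilyS2 (fun s => (d s).phiInf)
  smooth_Ar : ∀ n, SmoothFamilyS2 (fun s => (d s).Ar n)
  smooth_Aang : ∀ n, SmoothFamilyS2 (fun s => (d s).Aang n)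
  smooth_momr : ∀ n, SmoothFamilyS2 (fun s => (d s).momr n)
  smooth_momang : ∀ n, SmoothFamilyS2 (fun s => (d s).momang n)
  norm_phiInf : ∀ s x, ‖(d s).phiInf x‖ = a
  tangent_Aang : ∀ s n x, IsTangentAt x ((d s).Aang n x)
  tangent_momang : ∀ s n x, IsTangentAt x ((d s).momang n x)
  expansion_Ar : HasExpansionFamily
    (fun s x => ‖x‖ • radialPart (γ s).A x) (fun s => coeffAr (d s))
  expansion_Aang : ∀ j, HasExpansionFamily
    (fun s x => ‖x‖ • angularPart (γ s).A j x) (fun s => coeffAang e a (d s) j)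
  expansion_momr : HasExpansionFamily
    (fun s x => ‖x‖ ^ 2 • radialPart (γ s).mom x) (fun s => coeffMomr (d s))
  expansion_momang : ∀ j, HasExpansionFamily
    (fun s x => ‖x‖ ^ 2 • angularPart (γ s).mom j x) (fun s => coeffMomang (d s) j)
  expansion_phi : HasExpansionFamily (fun s => (γ s).phi) (fun s => coeffPhi (d s))
  expansion_phiMom : HasExpansionFamily (fun s => (γ s).phiMom) (fun _ _ _ => 0)
  /-- The leading order `∂_ā π̄^ā = 0` of the Gauss law. -/
  gauss : ∀ s x, sphereDiv ((d s).momang 0) x = 0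

/-- The parity conditions in the sector of magnetic charge `m`. Parity of angular tensor fields is
that of their Cartesian components. -/
structure ParityConditions (e a : ℝ) (m : ℤ) (d : AsymptoticData) : Prop where
  vacuum : IsVacuum a m d.phiInf
  Ar_odd : ∀ x, d.Ar 0 (-x) = - d.Ar 0 x
  momr_even : ∀ x, d.momr 0 (-x) = d.momr 0 x
  momang_odd : ∀ x, d.momang 0 (-x) = - d.momang 0 x
  Aang_eq : ∃ (Aeven : S2 → E3) (Φ : S2 → ℝ) (Agau φ' : S2 → E3),
    IsTangentField Aeven ∧ (∀ x, Aeven (-x) = Aeven x) ∧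
    SmoothS2 Φ ∧ (∀ x, Φ (-x) = Φ x) ∧
    IsVacuum a m φ' ∧ VolOdd φ' ∧
    IsTangentField Agau ∧ IsGaugeForm e a d.phiInf φ' Agau ∧
    ∀ x, d.Aang 0 x = Aeven x + sphereGrad Φ x + Agau x

/-- The tangent vector of a curve of canonical variables at the parameter value `0`. -/
def velocity (γ : ℝ → Fields) : Fields where
  A i x := deriv (fun s => (γ s).A i x) 0
  mom i x := deriv (fun s => (γ s).mom i x) 0
  phi x := deriv (fun s => (γ s).phi x) 0
  phiMom x := deriv (fun s => (γ s).phiMom x) 0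

/-- Finiteness of the symplectic potential
`Θ_p(v) = ∫ d³x π^i · ∂_s A_i + ∫ d³x Π · ∂_s φ`. The first integrand decays only like `r⁻³`, so its
integral is the limit of the integrals over balls (angular integration before the radial one);
the second integral converges absolutely. -/
def SymplecticPotentialFinite (p v : Fields) : Prop :=
  (∀ R : ℝ, IntegrableOn (fun x => ∑ i, inner ℝ (p.mom i x) (v.A i x)) (Metric.ball 0 R)) ∧
  (∃ L : ℝ, Tendsto
    (fun R : ℝ => ∫ x in Metric.ball (0 : E3) R, ∑ i, inner ℝ (p.mom i x) (v.A i x))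
    atTop (𝓝 L)) ∧
  Integrable (fun x => inner ℝ (p.phiMom x) (v.phi x))

end

noncomputable section

/-! ### Vector algebra in `E3` -/

/-! (i) On `S2` a two-form is a density times the area form (`volForm_eq_volDensity_mul`). Equal
charges give the difference of the two densities mean zero, and if `sphereDiv X` is that difference,
up to the constant, then `x ↦ x × X x` is the required one-form (`sphereExtDeriv_cross`). The
equation `div X = f` for mean-zero `f` (`exists_sphereDiv_eq`) is solved by rotations alone. For a
rotation `R` joined to the identity by rotations about the same axis, `f ∘ R - f` is the integral of
an angle derivative, hence a divergence, because infinitesimal rotations are divergence-free.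
Averaging about the vertical axis makes `f` zonal; averaging the zonal function over half-turns
makes it constant; the divergence theorem shows that the constant is zero.

(ii) The integrand is `r⁻³` times a function of the direction, up to `O(r⁻⁴)`. So the limit over
balls exists once that function, `leadingDensity`, has mean zero (`tendsto_setIntegral_ball`,
`integral_leadingDensity`). Its radial part is an even function times an odd one. Its angular part
is `a²` times the pairing of `π̄` with `α = ∂_s Ā - (e a⁴)⁻¹ φ · (∂_s φ × ∂φ)`. The variation of
`Vol_φ` is exact (`hasDerivAt_volForm`), so `dα` is the `s`-derivative of `dĀ - (e a⁴)⁻¹ Vol_φ`,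
which the parity conditions turn into `dA^even - (e a⁴)⁻¹ Vol_φ'`, an odd two-form. Hence the field
`α(x) - α(-x)` is closed, therefore exact on the sphere, therefore orthogonal to the divergence-free
`π̄`. Since `π̄` is odd, the terms `α(x)` and `-α(-x)` contribute equally to this pairing, and the
pairing of `π̄` with `α` vanishes (`integral_inner_eq_zero_of_parity`). -/

lemma inner_E3 (u v : E3) : inner ℝ u v = u 0 * v 0 + u 1 * v 1 + u 2 * v 2 := by
  simp [PiLp.inner_apply, Fin.sum_univ_three, mul_comm]

@[simp] lemma cross_apply_zero (u v : E3) : cross u v 0 = u 1 * v 2 - u 2 * v 1 := by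
  simp [cross, crossProduct]

@[simp] lemma cross_apply_one (u v : E3) : cross u v 1 = u 2 * v 0 - u 0 * v 2 := by
  simp [cross, crossProduct]

@[simp] lemma cross_apply_two (u v : E3) : cross u v 2 = u 0 * v 1 - u 1 * v 0 := by
  simp [cross, crossProduct]

@[simp] lemma basisVec_apply (i j : Fin 3) : basisVec i j = if j = i then 1 else 0 := by
  simp [basisVec]

lemma ext_E3 {u v : E3} (h0 : u 0 = v 0) (h1 : u 1 = v 1) (h2 : u 2 = v 2) : u = v := by
  ext i; fin_cases i <;> assumption

lemma eq_sum_basisVec (u : E3) : u = u 0 • basisVec 0 + u 1 • basisVec 1 + u 2 • basisVec 2 := by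
  apply ext_E3 <;> simp

/-- The vector product as a continuous bilinear map. -/
def crossL : E3 →L[ℝ] E3 →L[ℝ] E3 :=
  LinearMap.toContinuousLinearMap
    { toFun := fun u => LinearMap.toContinuousLinearMap
        { toFun := fun v => cross u v
          map_add' := fun v w => by apply ext_E3 <;> simp <;> ring
          map_smul' := fun c v => by apply ext_E3 <;> simp <;> ring }
      map_add' := fun u v => by
        ext w : 1
        apply ext_E3 <;> simp <;> ring
      map_smul' := fun c u => by
        ext w : 1
        apply ext_E3 <;> simp <;> ring }

lemma crossL_apply (u v : E3) : crossL u v = cross u v := rfl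

/-- The coordinate functionals. -/
def coordL (i : Fin 3) : E3 →L[ℝ] ℝ := EuclideanSpace.proj i

@[simp] lemma coordL_apply (i : Fin 3) (u : E3) : coordL i u = u i := rfl

/-- The triple product. -/
def triple (u v w : E3) : ℝ := inner ℝ u (cross v w)

lemma triple_eq (u v w : E3) : triple u v w =
    u 0 * (v 1 * w 2 - v 2 * w 1) + u 1 * (v 2 * w 0 - v 0 * w 2)
      + u 2 * (v 0 * w 1 - v 1 * w 0) := by
  simp [triple, inner_E3]

lemma norm_sq_S2 (x : S2) : (x : E3) 0 ^ 2 + (x : E3) 1 ^ 2 + (x : E3) 2 ^ 2 = 1 := by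
  have h : ‖(x : E3)‖ = 1 := by simp
  have h2 := real_inner_self_eq_norm_sq (x : E3)
  rw [inner_E3, h] at h2
  linarith

/-- By tangency `x × (u × w) = ⟨x, w⟩ u - ⟨x, u⟩ w` vanishes, so `u × w` is parallel to the unit
vector `x`. -/
lemma cross_eq_of_tangent {x : S2} {u w : E3} (hu : IsTangentAt x u) (hw : IsTangentAt x w) :
    cross u w = triple x u w • (x : E3) := by
  have hx := norm_sq_S2 x
  rw [IsTangentAt, inner_E3] at hu hw
  rw [triple_eq]
  set a := (x : E3) 0
  set b := (x : E3) 1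
  set c := (x : E3) 2
  apply ext_E3
  · simp only [cross_apply_zero, PiLp.smul_apply, smul_eq_mul]
    linear_combination (-(u 1 * w 2 - u 2 * w 1)) * hx + (-c * w 1 + b * w 2) * hu + (c * u 1 - b * u 2) * hw
  · simp only [cross_apply_one, PiLp.smul_apply, smul_eq_mul]
    linear_combination (-(u 2 * w 0 - u 0 * w 2)) * hx + (c * w 0 - a * w 2) * hu + (-c * u 0 + a * u 2) * hw
  · simp only [cross_apply_two, PiLp.smul_apply, smul_eq_mul]
    linear_combination (-(u 0 * w 1 - u 1 * w 0)) * hx + (-b * w 0 + a * w 1) * hu + (b * u 0 - a * u 1) * hw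

/-- The trace of a linear map acts on the triple product as a derivation. -/
lemma trace_mul_triple (M : E3 →L[ℝ] E3) (x u w : E3) :
    (∑ j, (M (basisVec j)) j) * triple x u w
      = triple (M x) u w + triple x (M u) w + triple x u (M w) := by
  have key : ∀ v : E3, ∀ i, (M v) i =
      v 0 * M (basisVec 0) i + v 1 * M (basisVec 1) i + v 2 * M (basisVec 2) i := by
    intro v i
    conv_lhs => rw [eq_sum_basisVec v]
    simp
  simp only [triple_eq, Fin.sum_univ_three, key x, key u, key w]
  ring

/-! ### Directions -/

lemma dir_of_ne {x : E3} (h : x ≠ 0) : (dir x : E3) = ‖x‖⁻¹ • x := by simp [dir, h]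

@[simp] lemma norm_S2 (x : S2) : ‖(x : E3)‖ = 1 := by simp

lemma S2_ne_zero (x : S2) : (x : E3) ≠ 0 := by
  intro h; have := norm_S2 x; simp [h] at this

@[simp] lemma dir_coe (x : S2) : dir (x : E3) = x := by
  ext1; rw [dir_of_ne (S2_ne_zero x)]; simp

lemma norm_smul_dir (x : E3) : ‖x‖ • (dir x : E3) = x := by
  by_cases h : x = 0
  · simp [h]
  · rw [dir_of_ne h, smul_smul, mul_inv_cancel₀ (norm_ne_zero_iff.2 h), one_smul]

lemma dir_smul {c : ℝ} (hc : 0 < c) (x : E3) : dir (c • x) = dir x := by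
  by_cases h : x = 0
  · simp [h]
  · ext1
    rw [dir_of_ne h, dir_of_ne (smul_ne_zero hc.ne' h), norm_smul, Real.norm_of_nonneg hc.le,
      smul_smul, mul_inv, mul_right_comm, inv_mul_cancel₀ hc.ne', one_mul]

lemma dir_neg {x : E3} (h : x ≠ 0) : dir (-x) = -dir x := by
  ext1
  rw [coe_neg_sphere, dir_of_ne h, dir_of_ne (neg_ne_zero.2 h)]
  simp

lemma dir_isometry (T : E3 ≃ₗᵢ[ℝ] E3) {x : E3} (h : x ≠ 0) : (dir (T x) : E3) = T (dir x) := by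
  have : T x ≠ 0 := by simpa using h
  rw [dir_of_ne h, dir_of_ne this]; simp

lemma contDiffOn_dir : ContDiffOn ℝ ∞ (fun y : E3 => (dir y : E3)) {0}ᶜ := by
  have : ContDiffOn ℝ ∞ (fun y : E3 => ‖y‖⁻¹ • y) {0}ᶜ := by
    refine ContDiffOn.fun_smul (ContDiffOn.inv ?_ ?_) contDiffOn_id
    · intro y hy
      exact (contDiffAt_norm ℝ hy).contDiffWithinAt
    · intro y hy; exact norm_ne_zero_iff.2 hy
  exact this.congr fun _ hy => dir_of_ne hy

lemma continuousOn_dir : ContinuousOn dir {0}ᶜ := by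
  rw [Topology.IsInducing.subtypeVal.continuousOn_iff]
  exact contDiffOn_dir.continuousOn

lemma measurable_dir : Measurable dir :=
  measurable_of_continuousOn_compl_singleton 0 continuousOn_dir

lemma hasFDerivAt_norm_S2 (x : S2) :
    HasFDerivAt (fun y : E3 => ‖y‖) (innerSL ℝ (x : E3)) (x : E3) := by
  have h1 := (hasStrictFDerivAt_norm_sq (x : E3)).hasFDerivAt.sqrt
    (pow_ne_zero 2 (norm_ne_zero_iff.2 (S2_ne_zero x)))
  have h2 : (fun y : E3 => √(‖y‖ ^ 2)) = fun y => ‖y‖ := by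
    ext y; exact Real.sqrt_sq (norm_nonneg _)
  rw [h2] at h1
  refine h1.congr_fderiv ?_
  rw [Real.sqrt_sq (norm_nonneg _), norm_S2]
  module

/-! ### Differentiation on the sphere -/

section Calculus

variable {F G H : Type*} [NormedAddCommGroup F] [NormedSpace ℝ F] [NormedAddCommGroup G]
  [NormedSpace ℝ G] [NormedAddCommGroup H] [NormedSpace ℝ H]

lemma isOpen_ne_zero : IsOpen ({0}ᶜ : Set E3) := isOpen_compl_singleton

lemma SmoothS2.contDiffAt {f : S2 → F} (hf : SmoothS2 f) {y : E3} (hy : y ≠ 0) :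
    ContDiffAt ℝ ∞ (fun y : E3 => f (dir y)) y :=
  ContDiffOn.contDiffAt hf (isOpen_ne_zero.mem_nhds hy)

lemma SmoothS2.differentiableAt {f : S2 → F} (hf : SmoothS2 f) {y : E3} (hy : y ≠ 0) :
    DifferentiableAt ℝ (fun y : E3 => f (dir y)) y :=
  (hf.contDiffAt hy).differentiableAt (by simp)

lemma SmoothS2.hasFDerivAt {f : S2 → F} (hf : SmoothS2 f) (x : S2) :
    HasFDerivAt (fun y : E3 => f (dir y)) (fderiv ℝ (fun y : E3 => f (dir y)) x) (x : E3) :=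
  (hf.differentiableAt (S2_ne_zero x)).hasFDerivAt

lemma SmoothS2.continuous {f : S2 → F} (hf : SmoothS2 f) : Continuous f := by
  have : f = (fun y : E3 => f (dir y)) ∘ (fun x : S2 => (x : E3)) := by ext x; simp
  rw [this]
  exact ContDiffOn.continuousOn hf |>.comp_continuous continuous_subtype_val S2_ne_zero

lemma smoothS2_const (c : F) : SmoothS2 (fun _ => c) := contDiffOn_const

lemma smoothS2_coe : SmoothS2 (fun x => (x : E3)) := contDiffOn_dir

lemma SmoothS2.add {f g : S2 → F} (hf : SmoothS2 f) (hg : SmoothS2 g) :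
    SmoothS2 (fun x => f x + g x) := ContDiffOn.add hf hg

lemma SmoothS2.sub {f g : S2 → F} (hf : SmoothS2 f) (hg : SmoothS2 g) :
    SmoothS2 (fun x => f x - g x) := ContDiffOn.sub hf hg

lemma SmoothS2.const_smul {f : S2 → F} (hf : SmoothS2 f) (c : ℝ) :
    SmoothS2 (fun x => c • f x) := ContDiffOn.const_smul c hf

lemma SmoothS2.smul {f : S2 → ℝ} {g : S2 → F} (hf : SmoothS2 f) (hg : SmoothS2 g) :
    SmoothS2 (fun x => f x • g x) := ContDiffOn.smul hf hg

lemma SmoothS2.clm (L : F →L[ℝ] G) {f : S2 → F} (hf : SmoothS2 f) :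
    SmoothS2 (fun x => L (f x)) := L.contDiff.comp_contDiffOn hf

lemma SmoothS2.bilin (L : F →L[ℝ] G →L[ℝ] H) {f : S2 → F} {g : S2 → G} (hf : SmoothS2 f)
    (hg : SmoothS2 g) : SmoothS2 (fun x => L (f x) (g x)) :=
  (L.contDiff.comp_contDiffOn hf).clm_apply hg

lemma SmoothS2.inner {f g : S2 → E3} (hf : SmoothS2 f) (hg : SmoothS2 g) :
    SmoothS2 (fun x => inner ℝ (f x) (g x)) := ContDiffOn.inner ℝ hf hg

lemma SmoothS2.cross {f g : S2 → E3} (hf : SmoothS2 f) (hg : SmoothS2 g) :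
    SmoothS2 (fun x => cross (f x) (g x)) := hf.bilin crossL hg

lemma SmoothS2.sum {ι : Type*} {s : Finset ι} {f : ι → S2 → F} (hf : ∀ i ∈ s, SmoothS2 (f i)) :
    SmoothS2 (fun x => ∑ i ∈ s, f i x) := ContDiffOn.sum hf

lemma SmoothS2.toLp {f : Fin 3 → S2 → ℝ} (hf : ∀ i, SmoothS2 (f i)) :
    SmoothS2 (fun x => (WithLp.toLp 2 (fun i => f i x) : E3)) := by
  unfold SmoothS2
  rw [contDiffOn_euclidean]
  exact hf

lemma sphereDeriv_add {f g : S2 → F} (hf : SmoothS2 f) (hg : SmoothS2 g) (x : S2) (u : E3) :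
    sphereDeriv (fun x => f x + g x) x u = sphereDeriv f x u + sphereDeriv g x u := by
  simp only [sphereDeriv]
  rw [((hf.hasFDerivAt x).fun_add (hg.hasFDerivAt x)).fderiv]; rfl

lemma sphereDeriv_sub {f g : S2 → F} (hf : SmoothS2 f) (hg : SmoothS2 g) (x : S2) (u : E3) :
    sphereDeriv (fun x => f x - g x) x u = sphereDeriv f x u - sphereDeriv g x u := by
  simp only [sphereDeriv]
  rw [((hf.hasFDerivAt x).fun_sub (hg.hasFDerivAt x)).fderiv]; rfl

lemma sphereDeriv_const_smul {f : S2 → F} (hf : SmoothS2 f) (c : ℝ) (x : S2) (u : E3) :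
    sphereDeriv (fun x => c • f x) x u = c • sphereDeriv f x u := by
  simp only [sphereDeriv]
  rw [((hf.hasFDerivAt x).fun_const_smul c).fderiv]; rfl

lemma sphereDeriv_bilin (L : F →L[ℝ] G →L[ℝ] H) {f : S2 → F} {g : S2 → G} (hf : SmoothS2 f)
    (hg : SmoothS2 g) (x : S2) (u : E3) :
    sphereDeriv (fun x => L (f x) (g x)) x u
      = L (f x) (sphereDeriv g x u) + L (sphereDeriv f x u) (g x) := by
  simp only [sphereDeriv]
  rw [(L.hasFDerivAt_of_bilinear (hf.hasFDerivAt x) (hg.hasFDerivAt x)).fderiv]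
  simp

lemma sphereDeriv_clm (L : F →L[ℝ] G) {f : S2 → F} (hf : SmoothS2 f) (x : S2) (u : E3) :
    sphereDeriv (fun x => L (f x)) x u = L (sphereDeriv f x u) := by
  simp only [sphereDeriv]
  have h : HasFDerivAt (fun y : E3 => L (f (dir y)))
      (L.comp (fderiv ℝ (fun y : E3 => f (dir y)) x)) (x : E3) :=
    L.hasFDerivAt.comp (x : E3) (hf.hasFDerivAt x)
  rw [h.fderiv]; rfl

lemma sphereDeriv_inner {f g : S2 → E3} (hf : SmoothS2 f) (hg : SmoothS2 g) (x : S2) (u : E3) :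
    sphereDeriv (fun x => inner ℝ (f x) (g x)) x u
      = inner ℝ (f x) (sphereDeriv g x u) + inner ℝ (sphereDeriv f x u) (g x) :=
  sphereDeriv_bilin (innerSL ℝ) hf hg x u

lemma sphereDeriv_cross {f g : S2 → E3} (hf : SmoothS2 f) (hg : SmoothS2 g) (x : S2) (u : E3) :
    sphereDeriv (fun x => cross (f x) (g x)) x u
      = cross (f x) (sphereDeriv g x u) + cross (sphereDeriv f x u) (g x) :=
  sphereDeriv_bilin crossL hf hg x u

lemma sphereDeriv_smul {f : S2 → ℝ} {g : S2 → F} (hf : SmoothS2 f) (hg : SmoothS2 g) (x : S2)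
    (u : E3) : sphereDeriv (fun x => f x • g x) x u
      = f x • sphereDeriv g x u + sphereDeriv f x u • g x :=
  sphereDeriv_bilin (ContinuousLinearMap.lsmul ℝ ℝ) hf hg x u

lemma sphereDeriv_comp_apply {f : S2 → E3} (hf : SmoothS2 f) (x : S2) (u : E3) (i : Fin 3) :
    sphereDeriv (fun x => f x i) x u = sphereDeriv f x u i :=
  sphereDeriv_clm (coordL i) hf x u

lemma SmoothS2.apply {f : S2 → E3} (hf : SmoothS2 f) (i : Fin 3) :
    SmoothS2 (fun x => f x i) := hf.clm (coordL i)

/-- The extension is homogeneous of degree zero, so its derivative is homogeneous of degree `-1`. -/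
lemma fderiv_radial_smul (f : S2 → F) {c : ℝ} (hc : 0 < c) (y : E3) :
    fderiv ℝ (fun y : E3 => f (dir y)) (c • y) = c⁻¹ • fderiv ℝ (fun y : E3 => f (dir y)) y := by
  have h := fderiv_comp_smul (𝕜 := ℝ) (f := fun y : E3 => f (dir y)) (x := y) c
  simp only [dir_smul hc] at h
  rw [h, smul_smul, inv_mul_cancel₀ hc.ne', one_smul]

lemma fderiv_radial_self (f : S2 → F) {y : E3}
    (hf : DifferentiableAt ℝ (fun y : E3 => f (dir y)) y) :
    fderiv ℝ (fun y : E3 => f (dir y)) y y = 0 := by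
  have h1 : HasDerivAt (fun t : ℝ => t • y) y 1 := by
    simpa using (hasDerivAt_id (1 : ℝ)).smul_const y
  have h2 : HasFDerivAt (fun y : E3 => f (dir y)) (fderiv ℝ (fun y : E3 => f (dir y)) y)
      ((1 : ℝ) • y) := by
    rw [one_smul]; exact hf.hasFDerivAt
  have h3 := h2.comp_hasDerivAt (1 : ℝ) h1
  have h4 : HasDerivAt ((fun y : E3 => f (dir y)) ∘ fun t : ℝ => t • y) 0 1 := by
    refine (hasDerivAt_const (1 : ℝ) (f (dir y))).congr_of_eventuallyEq ?_
    filter_upwards [lt_mem_nhds (zero_lt_one (α := ℝ))] with t ht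
    simp [dir_smul ht]
  exact h3.unique h4

lemma sphereDeriv_self {f : S2 → F} (hf : SmoothS2 f) (x : S2) : sphereDeriv f x x = 0 :=
  fderiv_radial_self f (hf.differentiableAt (S2_ne_zero x))

/-- The factor `‖y‖` undoes the homogeneity of degree `-1`. It gives the radially constant extension
of a derivative explicitly, so that derivatives can be iterated. -/
lemma sphereDeriv_dir (f : S2 → F) {y : E3} (hy : y ≠ 0) (u : E3) :
    sphereDeriv f (dir y) u = ‖y‖ • fderiv ℝ (fun y : E3 => f (dir y)) y u := by
  rw [sphereDeriv, dir_of_ne hy, fderiv_radial_smul f (inv_pos.2 (norm_pos_iff.2 hy)), inv_inv]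
  rfl

lemma SmoothS2.sphereDeriv {f : S2 → F} (hf : SmoothS2 f) (u : E3) :
    SmoothS2 (fun x => sphereDeriv f x u) := by
  have h : ContDiffOn ℝ ∞ (fun y : E3 => ‖y‖ • fderiv ℝ (fun y : E3 => f (dir y)) y u) {0}ᶜ := by
    apply ContDiffOn.smul
    · intro y hy
      exact (contDiffAt_norm ℝ hy).contDiffWithinAt
    · exact (ContDiffOn.fderiv_of_isOpen hf isOpen_ne_zero (by simp)).clm_apply contDiffOn_const
  exact h.congr fun _ hy => sphereDeriv_dir f hy u

lemma sphereDeriv_neg_arg {f : S2 → F} (x : S2) (u : E3) :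
    sphereDeriv (fun x => f (-x)) x u = - sphereDeriv f (-x) u := by
  have h : (fun y : E3 => f (-dir y)) =ᶠ[𝓝 (x : E3)] fun y => f (dir (-y)) := by
    filter_upwards [isOpen_ne_zero.mem_nhds (S2_ne_zero x)] with y hy
    rw [dir_neg hy]
  have h2 := fderiv_comp_smul (𝕜 := ℝ) (f := fun y : E3 => f (dir y)) (x := (x : E3)) (-1)
  simp only [neg_smul, one_smul] at h2
  rw [sphereDeriv, h.fderiv_eq, h2]
  rfl

lemma SmoothS2.neg_arg {f : S2 → F} (hf : SmoothS2 f) : SmoothS2 (fun x => f (-x)) := by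
  have : ContDiffOn ℝ ∞ (fun y : E3 => f (dir (-y))) {0}ᶜ :=
    ContDiffOn.comp (g := fun y : E3 => f (dir y)) hf contDiff_neg.contDiffOn
      (fun _ hy => by simpa using hy)
  exact this.congr fun _ hy => by simp only; rw [dir_neg hy]

/-- Second tangential derivatives commute. -/
lemma sphereDeriv_comm {f : S2 → F} (hf : SmoothS2 f) {x : S2} {u w : E3} (hu : IsTangentAt x u)
    (hw : IsTangentAt x w) :
    sphereDeriv (fun x => sphereDeriv f x w) x u = sphereDeriv (fun x => sphereDeriv f x u) x w := by
  -- The norm factor in the extension of the first derivative is stationary along the tangential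
  -- outer direction, so only the ordinary second derivative survives.
  have key : ∀ u w : E3, IsTangentAt x u → sphereDeriv (fun x => sphereDeriv f x w) x u
      = fderiv ℝ (fderiv ℝ (fun y : E3 => f (dir y))) x u w := by
    intro u w hu
    have h : (fun y : E3 => sphereDeriv f (dir y) w) =ᶠ[𝓝 (x : E3)]
        fun y => ‖y‖ • fderiv ℝ (fun y : E3 => f (dir y)) y w := by
      filter_upwards [isOpen_ne_zero.mem_nhds (S2_ne_zero x)] with y hy
      exact sphereDeriv_dir f hy w
    have hd : DifferentiableAt ℝ (fderiv ℝ (fun y : E3 => f (dir y))) (x : E3) :=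
      ((hf.contDiffAt (S2_ne_zero x)).fderiv_right (m := 1)
        (by norm_cast)).differentiableAt one_ne_zero
    have hn := hasFDerivAt_norm_S2 x
    rw [sphereDeriv, h.fderiv_eq,
      (hn.fun_smul (hd.hasFDerivAt.clm_apply (hasFDerivAt_const w (x : E3)))).fderiv]
    have hu' : inner ℝ (x : E3) u = 0 := hu
    simp [hu']
  rw [key u w hu, key w u hw]
  exact ((hf.contDiffAt (S2_ne_zero x)).isSymmSndFDerivAt (by simpa using ENat.LEInfty.out)).eq u w

end Calculus

/-! ### Integration on the sphere -/

/-- The area measure of the unit sphere. -/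
abbrev area : Measure S2 := (volume : Measure E3).toSphere

/-- Integration in polar coordinates of a function with separated variables. -/
lemma integral_radial_mul_angular (g : ℝ → ℝ) (h : S2 → ℝ) :
    ∫ y : E3, g ‖y‖ * h (dir y)
      = (∫ x, h x ∂area) * ∫ r : Set.Ioi (0 : ℝ), g r ∂(Measure.volumeIoiPow 2) := by
  have hdim : Module.finrank ℝ E3 - 1 = 2 := by simp
  have hmp := (volume : Measure E3).measurePreserving_homeomorphUnitSphereProd
  rw [hdim] at hmp
  calc ∫ y : E3, g ‖y‖ * h (dir y)
      = ∫ y : ({(0)}ᶜ : Set E3), g ‖(y : E3)‖ * h (dir y) ∂((volume : Measure E3).comap (↑)) := by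
        rw [integral_subtype_comap (measurableSet_singleton _).compl
          fun y : E3 => g ‖y‖ * h (dir y), restrict_compl_singleton]
    _ = ∫ p, h p.1 * g p.2 ∂(area.prod (Measure.volumeIoiPow 2)) := by
        rw [← hmp.integral_comp (Homeomorph.measurableEmbedding _)]
        congr 1
        ext y
        have : (homeomorphUnitSphereProd E3 y).1 = dir y := by
          ext1
          rw [homeomorphUnitSphereProd_apply_fst_coe, dir_of_ne y.2]
        rw [this, homeomorphUnitSphereProd_apply_snd_coe, mul_comm]
    _ = _ := integral_prod_mul (fun x => h x) (fun r : Set.Ioi (0 : ℝ) => g r)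

lemma SmoothS2.integrable {f : S2 → ℝ} (hf : SmoothS2 f) : Integrable f area :=
  hf.continuous.integrable_of_hasCompactSupport (HasCompactSupport.of_compactSpace f)

lemma area_real_univ_pos : 0 < area.real Set.univ := by
  rw [Measure.toSphere_real_apply_univ]
  have : 0 < (volume : Measure E3).real (Metric.ball 0 1) :=
    ENNReal.toReal_pos (Metric.measure_ball_pos _ _ one_pos).ne' measure_ball_lt_top.ne
  simpa using this

/-- A radial weight: a smooth function of `‖y‖²` supported in a shell. -/
def shellBump : ContDiffBump (2 : ℝ) where
  rIn := 1 / 2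
  rOut := 1
  rIn_pos := by norm_num
  rIn_lt_rOut := by norm_num

/-- A smooth radial function on space supported in a shell. -/
def shell (y : E3) : ℝ := shellBump (‖y‖ ^ 2)

lemma contDiff_shell : ContDiff ℝ ∞ shell :=
  shellBump.contDiff.comp (contDiff_norm_sq ℝ)

lemma shell_nonneg (y : E3) : 0 ≤ shell y := shellBump.nonneg

lemma tsupport_shell_subset : tsupport shell ⊆ {y | 1 ≤ ‖y‖ ^ 2 ∧ ‖y‖ ^ 2 ≤ 3} := by
  apply closure_minimal
  · intro y hy
    have h1 : ‖y‖ ^ 2 ∈ Function.support shellBump := hy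
    rw [shellBump.support_eq, Metric.mem_ball, Real.dist_eq, abs_lt] at h1
    simp only [shellBump] at h1
    exact ⟨by linarith [h1.1], by linarith [h1.2]⟩
  · exact (isClosed_le continuous_const (continuous_norm.pow 2)).inter
      (isClosed_le (continuous_norm.pow 2) continuous_const)

lemma tsupport_shell_ne_zero : tsupport shell ⊆ ({0}ᶜ : Set E3) := by
  intro y hy h0
  have := (tsupport_shell_subset hy).1
  simp only [Set.mem_singleton_iff] at h0
  subst h0; norm_num at this

lemma hasCompactSupport_shell : HasCompactSupport shell := by
  refine HasCompactSupport.of_support_subset_isCompact (isCompact_closedBall (0 : E3) 2) ?_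
  intro y hy
  have := (tsupport_shell_subset (subset_tsupport _ hy)).2
  rw [mem_closedBall_zero_iff]
  nlinarith [norm_nonneg y]

/-- The gradient of a radial function is radial. -/
lemma fderiv_shell (y u : E3) (h : inner ℝ y u = 0) : fderiv ℝ shell y u = 0 := by
  have h1 : HasFDerivAt (fun y : E3 => ‖y‖ ^ 2) (2 • innerSL ℝ y) y :=
    (hasStrictFDerivAt_norm_sq y).hasFDerivAt
  have h2 := (shellBump.contDiff (n := 1)).differentiable one_ne_zero (‖y‖ ^ 2)
  have h3 : HasFDerivAt shell _ y := h2.hasFDerivAt.comp y h1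
  rw [h3.fderiv]
  simp [h]

lemma integrable_of_shell {f g : E3 → ℝ} (hf : Continuous f) (hf' : HasCompactSupport f)
    (hf0 : tsupport f ⊆ {0}ᶜ) (hg : ContinuousOn g {0}ᶜ) :
    Integrable (fun y => f y * g y) := by
  apply Continuous.integrable_of_hasCompactSupport
  · refine (hf.continuousOn.mul hg).continuous_of_tsupport_subset isOpen_ne_zero ?_
    exact (tsupport_mul_subset_left (f := f) (g := g)).trans hf0
  · exact hf'.mul_right

lemma continuousOn_inv_norm : ContinuousOn (fun y : E3 => ‖y‖⁻¹) {0}ᶜ :=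
  continuousOn_id.norm.inv₀ fun _ hy => norm_ne_zero_iff.2 hy

lemma inner_dir_eq_zero {x : E3} {u : E3} (h : IsTangentAt (dir x) u) : inner ℝ x u = 0 := by
  have h' : inner ℝ (dir x : E3) u = 0 := h
  rw [← norm_smul_dir x, real_inner_smul_left, h', mul_zero]

/-- This radial factor is divided out when an identity of integrals over space is transferred to the
sphere. The weight `r⁻¹` matches the homogeneity of first derivatives of radially constant
functions. -/
lemma shellBump_weight_ne_zero :
    ∫ r : Set.Ioi (0 : ℝ), shellBump ((r : ℝ) ^ 2) * (r : ℝ)⁻¹ ∂(Measure.volumeIoiPow 2) ≠ 0 := by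
  intro h0
  have h1 := integral_radial_mul_angular (fun r => shellBump (r ^ 2) * r⁻¹) (fun _ => 1)
  rw [h0, mul_zero] at h1
  have h2 : 0 < ∫ y : E3, shell y * ‖y‖⁻¹ := by
    -- At norm `√2` the argument `‖y‖²` is the centre `2` of the bump, where its value is `1`.
    apply Continuous.integral_pos_of_hasCompactSupport_nonneg_nonzero (x := (√2 : ℝ) • basisVec 0)
    · refine (contDiff_shell.continuous.continuousOn.mul
        continuousOn_inv_norm).continuous_of_tsupport_subset isOpen_ne_zero ?_
      exact (tsupport_mul_subset_left (f := shell)).trans tsupport_shell_ne_zero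
    · exact hasCompactSupport_shell.mul_right
    · intro y
      exact mul_nonneg (shell_nonneg y) (inv_nonneg.2 (norm_nonneg y))
    · have h3 : ‖(√2 : ℝ) • basisVec 0‖ = √2 := by
        simp [norm_smul, basisVec, abs_of_nonneg]
      rw [shell, h3, Real.sq_sqrt (by norm_num), shellBump.one_of_mem_closedBall
        (Metric.mem_closedBall_self (by norm_num [shellBump]))]
      positivity
  apply h2.ne'
  simpa [shell] using h1

/-- The divergence theorem on the sphere. -/
theorem integral_sphereDiv {X : S2 → E3} (hX : IsTangentField X) :
    ∫ x, sphereDiv X x ∂area = 0 := by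
  have hsm : SmoothS2 X := hX.1
  have hc : ∀ j, ContDiffOn ℝ ∞ (fun y : E3 => X (dir y) j) {0}ᶜ := fun j => hsm.apply j
  have hi1 : ∀ j, Integrable (fun y => shell y * fderiv ℝ (fun y : E3 => X (dir y) j) y
      (basisVec j)) := by
    intro j
    refine integrable_of_shell contDiff_shell.continuous hasCompactSupport_shell
      tsupport_shell_ne_zero ?_
    exact ((hc j).continuousOn_fderiv_of_isOpen isOpen_ne_zero (by simp)).clm_apply
      continuousOn_const
  have hi2 : ∀ j, Integrable (fun y => fderiv ℝ shell y (basisVec j) * X (dir y) j) := by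
    intro j
    refine integrable_of_shell
      ((contDiff_shell.continuous_fderiv (by simp)).clm_apply continuous_const)
      (hasCompactSupport_shell.fderiv_apply ℝ _) ?_ (hc j).continuousOn
    exact (tsupport_fderiv_apply_subset ℝ _).trans tsupport_shell_ne_zero
  -- Integration by parts in space replaces Stokes on the sphere; the shell keeps away from the
  -- origin and from infinity.
  have hparts : ∀ j, ∫ y, shell y * fderiv ℝ (fun y : E3 => X (dir y) j) y (basisVec j)
      = - ∫ y, fderiv ℝ shell y (basisVec j) * X (dir y) j := by
    intro j
    refine integral_mul_fderiv_eq_neg_fderiv_mul_of_integrable (hi2 j) (hi1 j) ?_ ?_ ?_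
    · exact integrable_of_shell contDiff_shell.continuous hasCompactSupport_shell
        tsupport_shell_ne_zero (hc j).continuousOn
    · exact fun x _ => contDiff_shell.differentiable (by simp) x
    · intro x hx
      exact (hsm.apply j).differentiableAt (tsupport_shell_ne_zero hx)
  have hsum : ∫ y, ∑ j, shell y * fderiv ℝ (fun y : E3 => X (dir y) j) y (basisVec j) = 0 := by
    rw [integral_finsetSum _ fun j _ => hi1 j]
    simp_rw [hparts]
    rw [Finset.sum_neg_distrib, ← integral_finsetSum _ fun j _ => hi2 j, neg_eq_zero]
    apply integral_eq_zero_of_ae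
    refine Eventually.of_forall fun y => ?_
    -- After summation over `j` the other side contains only the derivative of the radial cutoff
    -- along the tangential field.
    have : fderiv ℝ shell y (X (dir y)) = 0 :=
      fderiv_shell y _ (inner_dir_eq_zero (hX.2 (dir y)))
    rw [eq_sum_basisVec (X (dir y))] at this
    simp only [map_add, map_smul, smul_eq_mul] at this
    simp only [Fin.sum_univ_three, Pi.zero_apply]
    linarith
  have hpol := integral_radial_mul_angular (fun r => shellBump (r ^ 2) * r⁻¹) (sphereDiv X)
  have heq : ∀ y : E3, ∑ j, shell y * fderiv ℝ (fun y : E3 => X (dir y) j) y (basisVec j)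
      = shellBump (‖y‖ ^ 2) * ‖y‖⁻¹ * sphereDiv X (dir y) := by
    intro y
    by_cases hy : y = 0
    · have : shell y = 0 := by
        by_contra h
        exact tsupport_shell_ne_zero (subset_tsupport _ h) hy
      have h' : shellBump (‖y‖ ^ 2) = 0 := this
      simp [this, h']
    · have hn : ‖y‖ ≠ 0 := norm_ne_zero_iff.2 hy
      have hd : ∀ j, sphereDeriv X (dir y) (basisVec j) j
          = ‖y‖ * fderiv ℝ (fun y : E3 => X (dir y) j) y (basisVec j) := fun j => by
        rw [← sphereDeriv_comp_apply hsm, sphereDeriv_dir _ hy, smul_eq_mul]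
      simp only [sphereDiv, hd, Fin.sum_univ_three, shell]
      field_simp
  simp_rw [heq] at hsum
  rw [hsum] at hpol
  exact (mul_eq_zero.1 hpol.symm).resolve_right shellBump_weight_ne_zero

/-- The rotation of the sphere induced by a linear isometry. -/
def sphereMap (T : E3 ≃ₗᵢ[ℝ] E3) (x : S2) : S2 := ⟨T x, by simp⟩

@[simp] lemma coe_sphereMap (T : E3 ≃ₗᵢ[ℝ] E3) (x : S2) : (sphereMap T x : E3) = T x := rfl

/-- The area measure is invariant under linear isometries. -/
theorem integral_comp_sphereMap (T : E3 ≃ₗᵢ[ℝ] E3) (h : S2 → ℝ) :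
    ∫ x, h (sphereMap T x) ∂area = ∫ x, h x ∂area := by
  have h1 := integral_radial_mul_angular (fun r => shellBump (r ^ 2) * r⁻¹) h
  have h2 := integral_radial_mul_angular (fun r => shellBump (r ^ 2) * r⁻¹)
    (fun x => h (sphereMap T x))
  -- Multiplied by the radial weight, both sides are integrals over space, where the isometry
  -- preserves Lebesgue measure and the norm.
  refine mul_right_cancel₀ shellBump_weight_ne_zero ?_
  rw [← h1, ← h2, ← T.measurePreserving.integral_comp T.toHomeomorph.measurableEmbedding
    (fun y => shellBump (‖y‖ ^ 2) * ‖y‖⁻¹ * h (dir y))]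
  apply integral_congr_ae
  refine Eventually.of_forall fun y => ?_
  by_cases hy : y = 0
  · simp [hy]
  · have : dir (T y) = sphereMap T (dir y) := by
      ext1; rw [dir_isometry T hy]; rfl
    simp [this]

theorem integral_comp_neg (h : S2 → ℝ) : ∫ x, h (-x) ∂area = ∫ x, h x ∂area := by
  rw [← integral_comp_sphereMap (LinearIsometryEquiv.neg ℝ) h]
  congr 1

theorem integral_eq_zero_of_odd {h : S2 → ℝ} (hh : ∀ x, h (-x) = - h x) :
    ∫ x, h x ∂area = 0 := by
  have := integral_comp_neg h
  simp only [hh, integral_neg] at this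
  linarith

/-- Integrals of zonal functions do not depend on the axis. -/
theorem integral_zonal (G : ℝ → ℝ) (x x' : S2) :
    ∫ v : S2, G (inner ℝ (v : E3) (x : E3)) ∂area = ∫ v : S2, G (inner ℝ (v : E3) (x' : E3)) ∂area := by
  -- The reflection in the plane orthogonal to `x' - x` exchanges the two axes.
  let T := (Submodule.span ℝ {(x' : E3) - (x : E3)})ᗮ.reflection
  have hT : T x' = x := Submodule.reflection_sub (by simp)
  rw [← integral_comp_sphereMap T (fun v => G (inner ℝ (v : E3) (x : E3)))]
  congr 1; ext v
  rw [← hT, coe_sphereMap, T.inner_map_map]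

/-! ### Smooth dependence of integrals on parameters -/

section Parametric

lemma aestronglyMeasurable_of_continuousOn_of_ae_mem {P G : Type} [NormedAddCommGroup P]
    [MeasurableSpace P] [BorelSpace P] [NormedAddCommGroup G]
    {ν : Measure P} {K : Set P} (hK : IsCompact K) (hν : ∀ᵐ p ∂ν, p ∈ K) {f : P → G}
    (hf : ContinuousOn f K) : AEStronglyMeasurable f ν := by
  have := hf.aestronglyMeasurable_of_isCompact (μ := ν) hK hK.measurableSet
  rwa [Measure.restrict_eq_self_of_ae_mem hν] at this

lemma integrable_of_continuousOn_of_ae_mem {P G : Type} [NormedAddCommGroup P]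
    [MeasurableSpace P] [BorelSpace P] [NormedAddCommGroup G]
    {ν : Measure P} [IsFiniteMeasure ν] {K : Set P} (hK : IsCompact K) (hν : ∀ᵐ p ∂ν, p ∈ K)
    {f : P → G} (hf : ContinuousOn f K) : Integrable f ν := by
  have := hf.integrableOn_compact' (μ := ν) hK hK.measurableSet
  rwa [IntegrableOn, Measure.restrict_eq_self_of_ae_mem hν] at this

variable {E P : Type} [NormedAddCommGroup E] [NormedSpace ℝ E] [FiniteDimensional ℝ E]
  [NormedAddCommGroup P] [NormedSpace ℝ P] [MeasurableSpace P] [BorelSpace P]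
  {ν : Measure P} [IsFiniteMeasure ν] {K : Set P} {U : Set E} {W : Set (E × P)}

/-- Differentiation under the integral over a compact set of parameters. -/
lemma hasFDerivAt_integral_of_compact {G : Type} [NormedAddCommGroup G] [NormedSpace ℝ G]
    (hK : IsCompact K) (hν : ∀ᵐ p ∂ν, p ∈ K) (hU : IsOpen U) (hW : IsOpen W)
    (hUK : U ×ˢ K ⊆ W) {F : E × P → G} (hF : ContDiffOn ℝ 1 F W) {x : E} (hx : x ∈ U) :
    HasFDerivAt (fun x => ∫ p, F (x, p) ∂ν)
      (∫ p, (fderiv ℝ F (x, p)).comp (ContinuousLinearMap.inl ℝ E P) ∂ν) x := by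
  have : ProperSpace E := FiniteDimensional.proper ℝ E
  obtain ⟨r, hr, hrU⟩ := Metric.nhds_basis_closedBall.mem_iff.1 (hU.mem_nhds hx)
  have hF' : ContinuousOn (fun q => (fderiv ℝ F q).comp (ContinuousLinearMap.inl ℝ E P)) W :=
    (hF.continuousOn_fderiv_of_isOpen hW le_rfl).clm_comp continuousOn_const
  obtain ⟨C, hC⟩ := ((isCompact_closedBall x r).prod hK).exists_bound_of_continuousOn
    (hF'.mono ((Set.prod_mono hrU le_rfl).trans hUK))
  have hslice : ∀ y ∈ U, ContinuousOn (fun p => F (y, p)) K := fun y hy =>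
    hF.continuousOn.comp (f := fun p => (y, p)) (by fun_prop) fun p hp => hUK ⟨hy, hp⟩
  refine hasFDerivAt_integral_of_dominated_of_fderiv_le (bound := fun _ => C)
    (F' := fun y p => (fderiv ℝ F (y, p)).comp (ContinuousLinearMap.inl ℝ E P))
    (Metric.closedBall_mem_nhds x hr) ?_ ?_ ?_ ?_ ?_ ?_
  · filter_upwards [hU.mem_nhds hx] with y hy
    exact aestronglyMeasurable_of_continuousOn_of_ae_mem hK hν (hslice y hy)
  · exact integrable_of_continuousOn_of_ae_mem hK hν (hslice x hx)
  · exact aestronglyMeasurable_of_continuousOn_of_ae_mem hK hν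
      (hF'.comp (f := fun p => (x, p)) (by fun_prop) fun p hp => hUK ⟨hx, hp⟩)
  · filter_upwards [hν] with p hp y hy
    exact hC (y, p) ⟨hy, hp⟩
  · exact integrable_const C
  · filter_upwards [hν] with p hp y hy
    have h1 := ((hF.contDiffAt (hW.mem_nhds (hUK (Set.mk_mem_prod (hrU hy) hp)))).differentiableAt
      one_ne_zero).hasFDerivAt
    exact h1.comp y (hasFDerivAt_prodMk_left y p)

/-- An integral over a compact set of parameters of a smooth integrand is smooth. -/
lemma contDiffOn_integral_of_compact {G : Type} [NormedAddCommGroup G] [NormedSpace ℝ G]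
    (hK : IsCompact K) (hν : ∀ᵐ p ∂ν, p ∈ K) (hU : IsOpen U) (hW : IsOpen W)
    (hUK : U ×ˢ K ⊆ W) {F : E × P → G} (hF : ContDiffOn ℝ ∞ F W) :
    ContDiffOn ℝ ∞ (fun x => ∫ p, F (x, p) ∂ν) U := by
  rw [contDiffOn_infty]
  intro n
  -- The target space must vary: the derivative is an integral of the same kind, with values in
  -- continuous linear maps.
  induction n generalizing G with
  | zero =>
    rw [CharP.cast_eq_zero, contDiffOn_zero]
    exact fun x hx => (hasFDerivAt_integral_of_compact hK hν hU hW hUK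
      (hF.of_le (by simp)) hx).continuousAt.continuousWithinAt
  | succ n ih =>
    have hd := fun x hx => hasFDerivAt_integral_of_compact hK hν hU hW hUK
      (hF.of_le (by simp)) (x := x) hx
    push_cast
    rw [contDiffOn_succ_iff_fderiv_of_isOpen hU]
    refine ⟨fun x hx => (hd x hx).differentiableAt.differentiableWithinAt, by simp, ?_⟩
    refine ContDiffOn.congr (ih (F := fun q => (fderiv ℝ F q).comp
      (ContinuousLinearMap.inl ℝ E P)) ?_) fun x hx => (hd x hx).fderiv
    exact (hF.fderiv_of_isOpen hW (by simp)).clm_comp contDiffOn_const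

end Parametric

/-! ### Rotations -/

/-- The rotation about the axis `n` by the angle `s` (Rodrigues' formula). -/
def rot (n : E3) (s : ℝ) (x : E3) : E3 :=
  Real.cos s • x + Real.sin s • cross n x + ((1 - Real.cos s) * inner ℝ n x) • n

lemma rot_apply (n : E3) (s : ℝ) (x : E3) (i : Fin 3) : rot n s x i =
    Real.cos s * x i + Real.sin s * cross n x i + (1 - Real.cos s) * inner ℝ n x * n i := by
  simp [rot]

lemma rot_smul (n : E3) (s c : ℝ) (x : E3) : rot n s (c • x) = c • rot n s x := by
  apply ext_E3 <;> simp [rot_apply, inner_E3] <;> ring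

lemma inner_rot_self (n : S2) (s : ℝ) (x : E3) :
    inner ℝ (rot n s x) (rot n s x) = inner ℝ x x := by
  have hn := norm_sq_S2 n
  have hs := Real.sin_sq_add_cos_sq s
  simp only [inner_E3, rot_apply, cross_apply_zero, cross_apply_one, cross_apply_two]
  set a := (n : E3) 0
  set b := (n : E3) 1
  set c := (n : E3) 2
  set C := Real.cos s
  set S := Real.sin s
  -- The identity is polynomial modulo `S² + C² = 1` and `a² + b² + c² = 1`; `S²` and the powers of
  -- `a` are eliminated.
  have hS : S ^ 2 = 1 - C ^ 2 := by linarith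
  have ha : a ^ 2 = 1 - b ^ 2 - c ^ 2 := by linarith
  ring_nf
  simp only [hS, ha, show a ^ 3 = a * (1 - b ^ 2 - c ^ 2) by rw [← ha]; ring,
    show a ^ 4 = (1 - b ^ 2 - c ^ 2) ^ 2 by rw [← ha]; ring]
  ring

lemma norm_rot (n : S2) (s : ℝ) (x : E3) : ‖rot n s x‖ = ‖x‖ := by
  have h := inner_rot_self n s x
  rw [real_inner_self_eq_norm_sq, real_inner_self_eq_norm_sq] at h
  exact (sq_eq_sq₀ (norm_nonneg _) (norm_nonneg _)).1 h

lemma rot_ne_zero (n : S2) (s : ℝ) {x : E3} (hx : x ≠ 0) : rot n s x ≠ 0 := by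
  rw [← norm_ne_zero_iff, norm_rot]; exact norm_ne_zero_iff.2 hx

/-- The rotation of the sphere about the axis `n` by the angle `s`. -/
def rotS (n : S2) (s : ℝ) (x : S2) : S2 := ⟨rot n s x, by simp [norm_rot]⟩

@[simp] lemma coe_rotS (n : S2) (s : ℝ) (x : S2) : (rotS n s x : E3) = rot n s x := rfl

lemma dir_rot (n : S2) (s : ℝ) {x : E3} (hx : x ≠ 0) : dir (rot n s x) = rotS n s (dir x) := by
  ext1
  rw [dir_of_ne (rot_ne_zero n s hx), norm_rot, coe_rotS, dir_of_ne hx, rot_smul]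

lemma contDiff_rot : ContDiff ℝ ∞ (fun q : E3 × (E3 × ℝ) => rot q.2.1 q.2.2 q.1) := by
  unfold rot
  have h1 : ContDiff ℝ ∞ (fun q : E3 × (E3 × ℝ) => cross q.2.1 q.1) :=
    (crossL.contDiff.comp (by fun_prop : ContDiff ℝ ∞ fun q : E3 × (E3 × ℝ) => q.2.1)).clm_apply
      contDiff_fst
  have h2 : ContDiff ℝ ∞ (fun q : E3 × (E3 × ℝ) => (inner ℝ q.2.1 q.1 : ℝ)) :=
    ContDiff.inner ℝ (by fun_prop) (by fun_prop)
  fun_prop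

/-- The derivative of a rotation with respect to the angle. -/
lemma hasDerivAt_rot (n : S2) (s : ℝ) (x : E3) :
    HasDerivAt (fun s => rot n s x) (rot n s (cross n x)) s := by
  have h := (((Real.hasDerivAt_cos s).smul_const x).add
    ((Real.hasDerivAt_sin s).smul_const (cross n x))).add
    ((((hasDerivAt_const s (1 : ℝ)).sub (Real.hasDerivAt_cos s)).mul_const
      (inner ℝ (n : E3) x)).smul_const (n : E3))
  -- The velocity is written as the rotated vector `n × x`, so that the angle derivative of a
  -- rotated function becomes its derivative along the field `n × x` at the original point.
  refine h.congr_deriv ?_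
  have hn := norm_sq_S2 n
  apply ext_E3 <;>
  simp only [rot_apply, inner_E3, cross_apply_zero, cross_apply_one, cross_apply_two,
    PiLp.add_apply, PiLp.smul_apply, smul_eq_mul]
  · linear_combination (x 0 * Real.sin s) * hn
  · linear_combination (x 1 * Real.sin s) * hn
  · linear_combination (x 2 * Real.sin s) * hn

lemma rot_add (n : S2) (s t : ℝ) (x : E3) : rot n s (rot n t x) = rot n (s + t) x := by
  have hn := norm_sq_S2 n
  have ha : (n : E3) 0 ^ 2 = 1 - (n : E3) 1 ^ 2 - (n : E3) 2 ^ 2 := by linarith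
  have ha3 : (n : E3) 0 ^ 3 = (n : E3) 0 * (1 - (n : E3) 1 ^ 2 - (n : E3) 2 ^ 2) := by
    rw [← ha]; ring
  have ha4 : (n : E3) 0 ^ 4 = (1 - (n : E3) 1 ^ 2 - (n : E3) 2 ^ 2) ^ 2 := by
    rw [← ha]; ring
  apply ext_E3 <;>
  simp only [rot_apply, inner_E3, cross_apply_zero, cross_apply_one, cross_apply_two,
    Real.cos_add, Real.sin_add] <;> ring_nf <;> simp only [ha, ha3, ha4] <;> ring

lemma rot_zero (n x : E3) : rot n 0 x = x := by simp [rot]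

lemma rot_two_pi (n x : E3) : rot n (2 * Real.pi) x = x := by simp [rot]

lemma sphereDeriv_coe (x : S2) (u : E3) :
    sphereDeriv (fun x : S2 => (x : E3)) x u = u - (inner ℝ (x : E3) u) • (x : E3) := by
  have h : (fun y : E3 => (dir y : E3)) =ᶠ[𝓝 (x : E3)] fun y => ‖y‖⁻¹ • y := by
    filter_upwards [isOpen_ne_zero.mem_nhds (S2_ne_zero x)] with y hy
    exact dir_of_ne hy
  have hn : HasFDerivAt (fun y : E3 => ‖y‖) (innerSL ℝ (x : E3)) (x : E3) := by
    exact hasFDerivAt_norm_S2 x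
  have h2 := ((hasDerivAt_inv (norm_ne_zero_iff.2 (S2_ne_zero x))).comp_hasFDerivAt (x : E3) hn)
  have h3 : HasFDerivAt (fun y : E3 => ‖y‖⁻¹ • y) _ (x : E3) := h2.smul (hasFDerivAt_id (x : E3))
  rw [sphereDeriv, h.fderiv_eq, h3.fderiv]
  simp [sub_eq_add_neg]

/-- The divergence of a product. -/
lemma sphereDiv_smul {g : S2 → ℝ} {Z : S2 → E3} (hg : SmoothS2 g) (hZ : SmoothS2 Z) (x : S2) :
    sphereDiv (fun x => g x • Z x) x = g x * sphereDiv Z x + sphereDeriv g x (Z x) := by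
  have h : sphereDeriv g x (Z x) = ∑ j, Z x j * sphereDeriv g x (basisVec j) := by
    conv_lhs => rw [eq_sum_basisVec (Z x)]
    simp [sphereDeriv, Fin.sum_univ_three]
  simp only [sphereDiv, sphereDeriv_smul hg hZ, h, Fin.sum_univ_three, PiLp.add_apply,
    PiLp.smul_apply, smul_eq_mul]
  ring

lemma isTangentAt_cross (n : E3) (x : S2) : IsTangentAt x (cross n x) := by
  rw [IsTangentAt, inner_E3]; simp; ring

lemma smoothS2_killing (n : E3) : SmoothS2 (fun x => cross n x) :=
  (smoothS2_const n).cross smoothS2_coe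

/-- Infinitesimal rotations are free of divergence. -/
lemma sphereDiv_killing (n : E3) (x : S2) : sphereDiv (fun x => cross n x) x = 0 := by
  have h : ∀ u, sphereDeriv (fun x : S2 => cross n x) x u
      = cross n (u - (inner ℝ (x : E3) u) • (x : E3)) := fun u => by
    have := sphereDeriv_clm (crossL n) smoothS2_coe x u
    rw [sphereDeriv_coe] at this
    exact this
  simp [sphereDiv, h, Fin.sum_univ_three, inner_E3]
  ring

/-- The rotation about `n` by the angle `s` as a linear map. -/
def rotL (n : E3) (s : ℝ) : E3 →L[ℝ] E3 :=
  Real.cos s • ContinuousLinearMap.id ℝ E3 + Real.sin s • crossL n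
    + (1 - Real.cos s) • (innerSL ℝ n).smulRight n

lemma rotL_apply (n : E3) (s : ℝ) (x : E3) : rotL n s x = rot n s x := by
  simp [rotL, rot, crossL_apply, smul_smul]

/-! ### Superpositions of infinitesimal rotations and their divergence -/

/-- The axes and angles of the rotations in use. -/
def rotParams : Set (E3 × ℝ) := Metric.sphere 0 1 ×ˢ Set.Icc 0 (2 * Real.pi)

lemma isCompact_rotParams : IsCompact rotParams := (isCompact_sphere 0 1).prod isCompact_Icc

/-- The integrand of `rotField`, extended to space. -/
def rotIntegrand (f : S2 → ℝ) (w : ℝ → ℝ) (q : E3 × (E3 × ℝ)) : E3 :=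
  (w q.2.2 * f (dir (rot q.2.1 q.2.2 q.1))) • (‖q.1‖⁻¹ • cross q.2.1 q.1)

/-- A superposition of infinitesimal rotations, weighted by rotated copies of `f`. -/
def rotField (f : S2 → ℝ) (w : ℝ → ℝ) (ν : Measure (E3 × ℝ)) (x : S2) : E3 :=
  ∫ p, rotIntegrand f w (x, p) ∂ν

lemma isOpen_rot_ne_zero : IsOpen {q : E3 × (E3 × ℝ) | rot q.2.1 q.2.2 q.1 ≠ 0} :=
  isOpen_ne_fun contDiff_rot.continuous continuous_const

/-- For an axis that is not of unit length Rodrigues' formula may annihilate a nonzero vector. The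
integrands are smooth on the open set where it does not, and unit axes stay inside that set because
they preserve the norm. -/
lemma prod_rotParams_subset : ({0}ᶜ : Set E3) ×ˢ rotParams ⊆
    {q : E3 × (E3 × ℝ) | rot q.2.1 q.2.2 q.1 ≠ 0} := by
  rintro ⟨x, n, s⟩ ⟨hx, hn, -⟩
  exact rot_ne_zero ⟨n, hn⟩ s hx

lemma contDiffOn_radial_rot {f : S2 → ℝ} (hf : SmoothS2 f) :
    ContDiffOn ℝ ∞ (fun q : E3 × (E3 × ℝ) => f (dir (rot q.2.1 q.2.2 q.1)))
      {q | rot q.2.1 q.2.2 q.1 ≠ 0} :=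
  ContDiffOn.comp (g := fun y : E3 => f (dir y)) hf contDiff_rot.contDiffOn fun _ hq => hq

lemma contDiffOn_rotIntegrand {f : S2 → ℝ} (hf : SmoothS2 f) {w : ℝ → ℝ} (hw : ContDiff ℝ ∞ w) :
    ContDiffOn ℝ ∞ (rotIntegrand f w) {q | rot q.2.1 q.2.2 q.1 ≠ 0} := by
  have h0 : ∀ q ∈ {q : E3 × (E3 × ℝ) | rot q.2.1 q.2.2 q.1 ≠ 0}, q.1 ≠ 0 := by
    intro q hq h
    apply hq
    rw [h]
    simpa using rot_smul q.2.1 q.2.2 0 0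
  refine ContDiffOn.fun_smul (ContDiffOn.mul ?_ (contDiffOn_radial_rot hf)) (ContDiffOn.fun_smul ?_ ?_)
  · exact (hw.comp (by fun_prop : ContDiff ℝ ∞ fun q : E3 × (E3 × ℝ) => q.2.2)).contDiffOn
  · refine ContDiffOn.inv ?_ fun q hq => norm_ne_zero_iff.2 (h0 q hq)
    intro q hq
    exact ((contDiffAt_norm ℝ (h0 q hq)).comp q contDiffAt_fst).contDiffWithinAt
  · exact ((crossL.contDiff.comp (by fun_prop : ContDiff ℝ ∞ fun q : E3 × (E3 × ℝ) =>
      q.2.1)).clm_apply contDiff_fst).contDiffOn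

/-- The factor `‖y‖⁻¹` makes the integrand homogeneous of degree zero, so on punctured space its
integral over the parameters is already the radially constant extension of `rotField`. -/
lemma rotIntegrand_dir (f : S2 → ℝ) (w : ℝ → ℝ) {y : E3} (hy : y ≠ 0) (p : E3 × ℝ) :
    rotIntegrand f w (dir y, p) = rotIntegrand f w (y, p) := by
  have hpos : 0 < ‖y‖⁻¹ := inv_pos.2 (norm_pos_iff.2 hy)
  simp only [rotIntegrand, norm_S2]
  rw [dir_of_ne hy, rot_smul, dir_smul hpos]
  congr 1
  rw [inv_one, one_smul]
  exact (crossL p.1).map_smul _ _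

lemma smoothS2_rot_average {f : S2 → ℝ} (hf : SmoothS2 f)
    {ν : Measure (E3 × ℝ)} [IsFiniteMeasure ν] (hν : ∀ᵐ p ∂ν, p ∈ rotParams) :
    SmoothS2 (fun x => ∫ p : E3 × ℝ, f (dir (rot p.1 p.2 x)) ∂ν) := by
  have h := contDiffOn_integral_of_compact (ν := ν) isCompact_rotParams hν isOpen_ne_zero
    isOpen_rot_ne_zero prod_rotParams_subset (contDiffOn_radial_rot hf)
  refine ContDiffOn.congr h fun y hy => ?_
  simp only
  congr 1 with p
  rw [dir_of_ne hy, rot_smul, dir_smul (inv_pos.2 (norm_pos_iff.2 hy))]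

lemma isTangentField_rotField {f : S2 → ℝ} (hf : SmoothS2 f) {w : ℝ → ℝ} (hw : ContDiff ℝ ∞ w)
    {ν : Measure (E3 × ℝ)} [IsFiniteMeasure ν] (hν : ∀ᵐ p ∂ν, p ∈ rotParams) : IsTangentField (rotField f w ν) := by
  constructor
  · have h := contDiffOn_integral_of_compact (ν := ν) isCompact_rotParams hν isOpen_ne_zero
      isOpen_rot_ne_zero prod_rotParams_subset (contDiffOn_rotIntegrand hf hw)
    refine ContDiffOn.congr h fun y hy => ?_
    simp only [rotField, rotIntegrand_dir f w hy]
  · intro x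
    have hint : Integrable (fun p => rotIntegrand f w (x, p)) ν :=
      integrable_of_continuousOn_of_ae_mem isCompact_rotParams hν
        ((contDiffOn_rotIntegrand hf hw).continuousOn.comp (f := fun p => ((x : E3), p))
          (by fun_prop) fun p hp => prod_rotParams_subset ⟨S2_ne_zero x, hp⟩)
    rw [IsTangentAt, rotField, ← integral_inner hint]
    apply integral_eq_zero_of_ae
    refine Eventually.of_forall fun p => ?_
    have h : inner ℝ (x : E3) (cross p.1 x) = 0 := isTangentAt_cross p.1 x
    simp [rotIntegrand, inner_smul_right, h]

/-- The derivative of a rotated function along the axis angle. -/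
lemma deriv_radial_rot {f : S2 → ℝ} (hf : SmoothS2 f) (n : S2) (s : ℝ) (x : S2) :
    HasDerivAt (fun s => f (dir (rot n s x)))
      (sphereDeriv (fun x => f (rotS n s x)) x (cross n x)) s := by
  have hne := rot_ne_zero n s (S2_ne_zero x)
  have h1 := (hf.differentiableAt hne).hasFDerivAt
  have h2 := h1.comp_hasDerivAt s (hasDerivAt_rot n s x)
  refine h2.congr_deriv ?_
  have h3 : (fun y : E3 => f (rotS n s (dir y))) =ᶠ[𝓝 (x : E3)]
      fun y => f (dir (rotL n s y)) := by
    filter_upwards [isOpen_ne_zero.mem_nhds (S2_ne_zero x)] with y hy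
    rw [rotL_apply, dir_rot n s hy]
  rw [sphereDeriv, h3.fderiv_eq]
  rw [← rotL_apply] at h1
  have h4 : HasFDerivAt (fun y : E3 => f (dir (rotL n s y))) _ (x : E3) :=
    h1.comp (x : E3) (rotL n s).hasFDerivAt
  rw [h4.fderiv]
  simp [rotL_apply]

/-- For one axis and angle the field is a rotated copy of `f` times a divergence-free infinitesimal
rotation. Its divergence is the derivative of the rotated copy along that rotation, which is the
derivative in the angle (`deriv_radial_rot`). -/
theorem sphereDiv_rotField {f : S2 → ℝ} (hf : SmoothS2 f) {w : ℝ → ℝ} (hw : ContDiff ℝ ∞ w)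
    {ν : Measure (E3 × ℝ)} [IsFiniteMeasure ν] (hν : ∀ᵐ p ∂ν, p ∈ rotParams) (x : S2) : sphereDiv (rotField f w ν) x =
    ∫ p : E3 × ℝ, w p.2 * deriv (fun s => f (dir (rot p.1 s x))) p.2 ∂ν := by
  have hx := S2_ne_zero x
  have hF := contDiffOn_rotIntegrand hf hw
  have hd := hasFDerivAt_integral_of_compact (ν := ν) isCompact_rotParams hν isOpen_ne_zero
    isOpen_rot_ne_zero prod_rotParams_subset (hF.of_le (by simp)) (x := (x : E3)) hx
  have hloc : (fun y : E3 => rotField f w ν (dir y)) =ᶠ[𝓝 (x : E3)]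
      fun y => ∫ p, rotIntegrand f w (y, p) ∂ν := by
    filter_upwards [isOpen_ne_zero.mem_nhds hx] with y hy
    simp only [rotField, rotIntegrand_dir f w hy]
  -- The divergence is the trace of the derivative, a continuous linear functional, and therefore
  -- passes under the integral.
  let Λ : (E3 →L[ℝ] E3) →L[ℝ] ℝ :=
    ∑ j, (coordL j).comp (ContinuousLinearMap.apply ℝ E3 (basisVec j))
  have hΛ : ∀ M, Λ M = ∑ j, M (basisVec j) j := fun M => by simp [Λ]
  have hint : Integrable (fun p => (fderiv ℝ (rotIntegrand f w) ((x : E3), p)).comp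
      (ContinuousLinearMap.inl ℝ E3 (E3 × ℝ))) ν := by
    refine integrable_of_continuousOn_of_ae_mem isCompact_rotParams hν ?_
    refine ContinuousOn.clm_comp ?_ continuousOn_const
    exact (hF.continuousOn_fderiv_of_isOpen isOpen_rot_ne_zero (by simp)).comp
      (f := fun p => ((x : E3), p)) (by fun_prop) fun p hp => prod_rotParams_subset ⟨hx, hp⟩
  have h1 : sphereDiv (rotField f w ν) x = Λ (fderiv ℝ (fun y : E3 => rotField f w ν (dir y)) x) := by
    rw [hΛ]; rfl
  rw [h1, hloc.fderiv_eq, hd.fderiv, ← Λ.integral_comp_comm hint]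
  apply integral_congr_ae
  filter_upwards [hν] with p hp
  obtain ⟨n, s⟩ := p
  let n' : S2 := ⟨n, hp.1⟩
  have hF' := ((hF.contDiffAt (isOpen_rot_ne_zero.mem_nhds
    (prod_rotParams_subset (Set.mk_mem_prod (a := (x : E3)) hx hp)))).differentiableAt
    (by simp)).hasFDerivAt
  have hA : HasFDerivAt (fun y : E3 => rotIntegrand f w (y, (n, s))) _ (x : E3) :=
    HasFDerivAt.comp (g := rotIntegrand f w) (x : E3) hF'
      (hasFDerivAt_prodMk_left (x : E3) (n, s))
  have hloc2 : (fun y : E3 => (w s * f (rotS n' s (dir y))) • cross n (dir y)) =ᶠ[𝓝 (x : E3)]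
      fun y => rotIntegrand f w (y, (n, s)) := by
    filter_upwards [isOpen_ne_zero.mem_nhds hx] with y hy
    rw [← rotIntegrand_dir f w hy, rotIntegrand]
    have : dir (rot n s (dir y)) = rotS n' s (dir y) := by
      rw [← dir_coe (rotS n' s (dir y)), coe_rotS]
    simp [this]
  have hsm : SmoothS2 (fun x => f (rotS n' s x)) := by
    have : ContDiffOn ℝ ∞ (fun y : E3 => f (dir (rotL n s y))) {0}ᶜ :=
      ContDiffOn.comp (g := fun y : E3 => f (dir y)) hf (rotL n s).contDiff.contDiffOn
        fun y hy => by
          simp only [rotL_apply]; exact rot_ne_zero n' s hy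
    refine this.congr fun y hy => ?_
    simp only [rotL_apply]
    rw [← dir_rot n' s hy]
  have h2 : Λ ((fderiv ℝ (rotIntegrand f w) ((x : E3), (n, s))).comp
      (ContinuousLinearMap.inl ℝ E3 (E3 × ℝ)))
      = sphereDiv (fun x => (w s * f (rotS n' s x)) • cross n x) x := by
    rw [hΛ, sphereDiv]
    simp only [sphereDeriv]
    rw [hloc2.fderiv_eq, hA.fderiv]
  have h3 : SmoothS2 (fun x => w s * f (rotS n' s x)) := hsm.const_smul (w s)
  have h4 := sphereDeriv_const_smul hsm (w s) x (cross n x)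
  simp only [smul_eq_mul] at h4
  rw [h2, sphereDiv_smul h3 (smoothS2_killing n), sphereDiv_killing, mul_zero, zero_add, h4]
  congr 1
  exact (deriv_radial_rot hf n' s x).deriv.symm

lemma contDiff_radial_rot {f : S2 → ℝ} (hf : SmoothS2 f) (n x : S2) :
    ContDiff ℝ ∞ (fun s => f (dir (rot n s x))) := by
  have h : ContDiff ℝ ∞ (fun s : ℝ => rot n s x) :=
    ContDiff.comp (g := fun q : E3 × (E3 × ℝ) => rot q.2.1 q.2.2 q.1)
      (f := fun s : ℝ => ((x : E3), ((n : E3), s))) contDiff_rot (by fun_prop)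
  rw [← contDiffOn_univ] at h ⊢
  exact ContDiffOn.comp (g := fun y : E3 => f (dir y)) (f := fun s => rot n s x) (t := {0}ᶜ) hf h
    fun s _ => rot_ne_zero n s (S2_ne_zero x)

lemma continuousOn_deriv_radial_rot {f : S2 → ℝ} (hf : SmoothS2 f) (x : S2) :
    ContinuousOn (fun p : E3 × ℝ => deriv (fun s => f (dir (rot p.1 s x))) p.2) rotParams := by
  have hF := contDiffOn_radial_rot hf
  have h : ContinuousOn (fun p : E3 × ℝ => fderiv ℝ
      (fun q : E3 × (E3 × ℝ) => f (dir (rot q.2.1 q.2.2 q.1))) ((x : E3), p) (0, (0, 1)))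
      rotParams :=
    ((hF.continuousOn_fderiv_of_isOpen isOpen_rot_ne_zero (by simp)).comp
      (f := fun p => ((x : E3), p)) (by fun_prop) fun p hp =>
        prod_rotParams_subset ⟨S2_ne_zero x, hp⟩).clm_apply continuousOn_const
  refine h.congr fun p hp => ?_
  have h1 := ((hF.contDiffAt (isOpen_rot_ne_zero.mem_nhds
    (prod_rotParams_subset (Set.mk_mem_prod (a := (x : E3)) (S2_ne_zero x) hp)))).differentiableAt
    (by simp)).hasFDerivAt
  have h2 : HasDerivAt (fun s : ℝ => ((x : E3), (p.1, s))) (0, (0, 1)) p.2 :=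
    (hasDerivAt_const _ _).prodMk ((hasDerivAt_const _ _).prodMk (hasDerivAt_id _))
  exact (HasFDerivAt.comp_hasDerivAt (f := fun s : ℝ => ((x : E3), (p.1, s))) p.2 h1 h2).deriv

lemma sphereDiv_sub {X Y : S2 → E3} (hX : SmoothS2 X) (hY : SmoothS2 Y) (x : S2) :
    sphereDiv (fun x => X x - Y x) x = sphereDiv X x - sphereDiv Y x := by
  simp [sphereDiv, sphereDeriv_sub hX hY, Finset.sum_sub_distrib]

lemma sphereDiv_const_smul {X : S2 → E3} (hX : SmoothS2 X) (c : ℝ) (x : S2) :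
    sphereDiv (fun x => c • X x) x = c * sphereDiv X x := by
  simp [sphereDiv, sphereDeriv_const_smul hX, Finset.mul_sum]

lemma IsTangentField.sub {X Y : S2 → E3} (hX : IsTangentField X) (hY : IsTangentField Y) :
    IsTangentField (fun x => X x - Y x) :=
  ⟨hX.1.sub hY.1, fun x => by
    have h1 := hX.2 x; have h2 := hY.2 x
    unfold IsTangentAt at *
    rw [inner_sub_right, h1, h2, sub_zero]⟩

lemma IsTangentField.const_smul {X : S2 → E3} (hX : IsTangentField X) (c : ℝ) :
    IsTangentField (fun x => c • X x) :=
  ⟨hX.1.const_smul c, fun x => by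
    have h1 := hX.2 x
    unfold IsTangentAt at *
    rw [inner_smul_right, h1, mul_zero]⟩

/-! ### Averaging over rotations -/

/-- The north pole. -/
def pole : S2 := ⟨basisVec 2, by simp [basisVec]⟩

@[simp] lemma coe_pole : (pole : E3) = basisVec 2 := rfl

/-- The average of a function over the rotations about the vertical axis. -/
def axisAverage (f : S2 → ℝ) (x : S2) : ℝ :=
  (2 * Real.pi)⁻¹ * ∫ s in (0 : ℝ)..(2 * Real.pi), f (dir (rot pole s x))

/-- The distribution of rotations about the vertical axis. -/
def axisMeasure : Measure (E3 × ℝ) :=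
  (volume.restrict (Set.Icc 0 (2 * Real.pi))).map (fun s => ((pole : E3), s))

instance : IsFiniteMeasure axisMeasure := by
  unfold axisMeasure
  infer_instance

lemma axisMeasure_ae : ∀ᵐ p ∂axisMeasure, p ∈ rotParams := by
  refine (ae_map_iff (by fun_prop) (p := fun p => p ∈ rotParams)
    isCompact_rotParams.measurableSet).2 ?_
  filter_upwards [ae_restrict_mem measurableSet_Icc] with s hs
  exact ⟨pole.2, hs⟩

lemma integral_axisMeasure {g : E3 × ℝ → ℝ} (hg : ContinuousOn g rotParams) :
    ∫ p, g p ∂axisMeasure = ∫ s in (0 : ℝ)..(2 * Real.pi), g (pole, s) := by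
  have h := (integrable_of_continuousOn_of_ae_mem isCompact_rotParams axisMeasure_ae
    hg).aestronglyMeasurable
  rw [intervalIntegral.integral_of_le Real.two_pi_pos.le, ← integral_Icc_eq_integral_Ioc]
  rw [axisMeasure] at h ⊢
  exact integral_map (by fun_prop) h

lemma smoothS2_axisAverage {f : S2 → ℝ} (hf : SmoothS2 f) : SmoothS2 (axisAverage f) := by
  have h := (smoothS2_rot_average hf axisMeasure_ae).const_smul (2 * Real.pi)⁻¹
  convert h using 2 with x
  rw [axisAverage, smul_eq_mul, integral_axisMeasure (g := fun p => f (dir (rot p.1 p.2 x)))]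
  exact (contDiffOn_radial_rot hf).continuousOn.comp (f := fun p => ((x : E3), p))
    (by fun_prop) fun p hp => prod_rotParams_subset ⟨S2_ne_zero x, hp⟩

/-- A function differs from its average over the rotations about an axis by a divergence. -/
lemma exists_sphereDiv_eq_sub_axisAverage {f : S2 → ℝ} (hf : SmoothS2 f) :
    ∃ X, IsTangentField X ∧ ∀ x, sphereDiv X x = f x - axisAverage f x := by
  -- The weight is the angle itself: integration by parts over a full turn gives the boundary term
  -- `2π f x`, since the full turn is the identity, minus the integral that defines the average.
  have hX := isTangentField_rotField hf contDiff_id axisMeasure_ae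
  refine ⟨_, hX.const_smul (2 * Real.pi)⁻¹, fun x => ?_⟩
  have hg := contDiff_radial_rot hf pole x
  have h1 : ∫ s in (0 : ℝ)..(2 * Real.pi), s * deriv (fun s => f (dir (rot pole s x))) s
      = 2 * Real.pi * f x - ∫ s in (0 : ℝ)..(2 * Real.pi), f (dir (rot pole s x)) := by
    rw [intervalIntegral.integral_mul_deriv_eq_deriv_mul (u := fun s => s) (u' := fun _ => 1)
      (v := fun s => f (dir (rot pole s x)))]
    · simp [rot_two_pi]
    · exact fun s _ => hasDerivAt_id s
    · exact fun s _ => (hg.differentiable (by simp) s).hasDerivAt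
    · exact intervalIntegrable_const
    · exact (hg.continuous_deriv (by simp)).intervalIntegrable _ _
  rw [sphereDiv_const_smul hX.1, sphereDiv_rotField hf contDiff_id axisMeasure_ae,
    integral_axisMeasure (g := fun p => id p.2 * deriv (fun s => f (dir (rot p.1 s x))) p.2)]
  · simp only [id]
    rw [h1, axisAverage]
    have := Real.pi_pos.ne'
    field_simp
  · exact continuousOn_snd.mul (continuousOn_deriv_radial_rot hf x)

/-- At equal height on the unit sphere the horizontal parts, read as complex numbers, have equal
modulus and differ by a phase. -/
lemma exists_rot_pole_eq {x x' : S2} (h : (x : E3) 2 = (x' : E3) 2) :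
    ∃ t : ℝ, rot pole t x = x' := by
  have hx := norm_sq_S2 x
  have hx' := norm_sq_S2 x'
  set z : ℂ := ⟨(x : E3) 0, (x : E3) 1⟩
  set z' : ℂ := ⟨(x' : E3) 0, (x' : E3) 1⟩
  have hn : ‖z‖ = ‖z'‖ := by
    rw [← sq_eq_sq₀ (norm_nonneg _) (norm_nonneg _), Complex.sq_norm, Complex.sq_norm,
      Complex.normSq_apply, Complex.normSq_apply]
    simp only [z, z']
    rw [h] at hx
    linarith
  obtain ⟨t, ht⟩ : ∃ t : ℝ, Complex.exp (t * Complex.I) * z = z' := by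
    by_cases hz : z = 0
    · refine ⟨0, ?_⟩
      rw [hz, norm_zero] at hn
      rw [hz, norm_eq_zero.1 hn.symm, mul_zero]
    · refine ⟨(z' / z).arg, ?_⟩
      have h1 := Complex.norm_mul_exp_arg_mul_I (z' / z)
      rw [norm_div, hn, div_self (by rw [← hn]; exact norm_ne_zero_iff.2 hz), Complex.ofReal_one,
        one_mul] at h1
      rw [h1, div_mul_cancel₀ _ hz]
  refine ⟨t, ?_⟩
  rw [Complex.exp_mul_I, ← Complex.ofReal_cos, ← Complex.ofReal_sin] at ht
  have hre := congrArg Complex.re ht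
  have him := congrArg Complex.im ht
  simp [z, z'] at hre him
  rw [Complex.cos_ofReal_re, Complex.sin_ofReal_re] at hre him
  apply ext_E3
  · simp [rot_apply, inner_E3]; linarith
  · simp [rot_apply, inner_E3]; linarith
  · simp [rot_apply, inner_E3]; linarith

/-- Averages over the rotations about an axis are zonal functions. -/
lemma axisAverage_eq_of_height_eq {f : S2 → ℝ} {x x' : S2}
    (h : (x : E3) 2 = (x' : E3) 2) : axisAverage f x = axisAverage f x' := by
  obtain ⟨t, ht⟩ := exists_rot_pole_eq h
  -- A rotation about the axis only shifts the angle, which does not change the integral over a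
  -- period.
  have hper : Function.Periodic (fun s => f (dir (rot pole s x))) (2 * Real.pi) := by
    intro s
    simp only
    rw [← rot_add, rot_two_pi]
  have h1 := hper.intervalIntegral_add_eq 0 t
  rw [axisAverage, axisAverage]
  congr 1
  rw [← ht]
  simp_rw [rot_add]
  rw [intervalIntegral.integral_comp_add_right (fun s => f (dir (rot pole s x)))]
  rw [zero_add] at h1 ⊢
  rw [h1, add_comm]

/-! ### Half-turns and the solution of the divergence equation -/

/-- The half-turn that exchanges `v` and the north pole. -/
def halfTurnAxis (v : S2) : S2 := dir ((v : E3) + basisVec 2)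

lemma measurable_halfTurnAxis : Measurable halfTurnAxis :=
  measurable_dir.comp (by fun_prop)

/-- A half-turn is a symmetric map, so the height of the image of `x` is the scalar product of `x`
with the image of the pole, which is `v`. -/
lemma rot_halfTurnAxis_height (v x : S2) :
    rot (halfTurnAxis v) Real.pi x 2 = inner ℝ (v : E3) (x : E3) := by
  have hv := norm_sq_S2 v
  simp only [rot_apply, Real.cos_pi, Real.sin_pi, inner_E3]
  -- At the south pole `dir 0` takes its default value, a horizontal direction; the half-turn about
  -- it still exchanges the two poles.
  by_cases h : (v : E3) + basisVec 2 = 0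
  · have hc : ∀ i, (v : E3) i + basisVec 2 i = 0 := fun i => by
      have := congrArg (fun u : E3 => u i) h
      simpa using this
    have h0 := hc 0; have h1 := hc 1; have h2 := hc 2
    simp at h0 h1 h2
    have h3 : (halfTurnAxis v : E3) = EuclideanSpace.single 0 1 := by
      simp [halfTurnAxis, dir, h]
    rw [h3, h0, h1, show (v : E3) 2 = -1 by linarith]
    simp
  · have h3 : (halfTurnAxis v : E3) = ‖(v : E3) + basisVec 2‖⁻¹ • ((v : E3) + basisVec 2) :=
      dir_of_ne h
    have h4 : ‖(v : E3) + basisVec 2‖ ^ 2 = 2 * (1 + (v : E3) 2) := by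
      rw [← real_inner_self_eq_norm_sq, inner_E3]
      simp
      linarith
    have h5 : ‖(v : E3) + basisVec 2‖ ≠ 0 := norm_ne_zero_iff.2 h
    rw [h3]
    simp
    field_simp
    rw [h4]
    ring

/-- The axis jumps at the south pole, so only measurability in `v` is claimed. -/
lemma measurable_dir_halfTurn (x : S2) :
    Measurable (fun v => dir (rot (halfTurnAxis v) Real.pi x)) := by
  refine measurable_dir.comp (Measurable.comp (g := fun q : E3 × (E3 × ℝ) => rot q.2.1 q.2.2 q.1)
    (f := fun v => ((x : E3), ((halfTurnAxis v : E3), Real.pi))) contDiff_rot.continuous.measurable ?_)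
  exact measurable_const.prodMk
    ((measurable_subtype_coe.comp measurable_halfTurnAxis).prodMk measurable_const)

/-- The distribution of the half-turns, with their paths to the identity. -/
def halfTurnMeasure : Measure (E3 × ℝ) :=
  (area.prod (volume.restrict (Set.Icc 0 Real.pi))).map
    (fun q => ((halfTurnAxis q.1 : E3), q.2))

lemma measurable_halfTurn_param :
    Measurable (fun q : S2 × ℝ => ((halfTurnAxis q.1 : E3), q.2)) :=
  ((measurable_subtype_coe.comp measurable_halfTurnAxis).comp measurable_fst).prodMk measurable_snd

instance : IsFiniteMeasure halfTurnMeasure := by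
  unfold halfTurnMeasure
  infer_instance

lemma halfTurnMeasure_ae : ∀ᵐ p ∂halfTurnMeasure, p ∈ rotParams := by
  refine (ae_map_iff measurable_halfTurn_param.aemeasurable (p := fun p => p ∈ rotParams)
    isCompact_rotParams.measurableSet).2 ?_
  have h := (Measure.quasiMeasurePreserving_snd (μ := area)
    (ν := volume.restrict (Set.Icc 0 Real.pi))).ae (ae_restrict_mem measurableSet_Icc)
  filter_upwards [h] with q hq
  exact ⟨(halfTurnAxis q.1).2, hq.1, hq.2.trans (by linarith [Real.pi_pos])⟩

lemma integral_halfTurnMeasure {g : E3 × ℝ → ℝ} (hg : ContinuousOn g rotParams) :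
    ∫ p, g p ∂halfTurnMeasure
      = ∫ v, (∫ s in (0 : ℝ)..Real.pi, g (halfTurnAxis v, s)) ∂area := by
  have h := integrable_of_continuousOn_of_ae_mem isCompact_rotParams halfTurnMeasure_ae hg
  rw [halfTurnMeasure] at h ⊢
  rw [integral_map measurable_halfTurn_param.aemeasurable h.aestronglyMeasurable]
  rw [integrable_map_measure h.aestronglyMeasurable measurable_halfTurn_param.aemeasurable] at h
  have h2 := integral_prod _ h
  simp only [Function.comp_def] at h2
  rw [h2]
  congr 1 with v
  rw [intervalIntegral.integral_of_le Real.pi_pos.le, ← integral_Icc_eq_integral_Ioc]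

/-- On the sphere every smooth function of mean zero is a divergence. -/
theorem exists_sphereDiv_eq {f : S2 → ℝ} (hf : SmoothS2 f) (h0 : ∫ x, f x ∂area = 0) :
    ∃ X, IsTangentField X ∧ ∀ x, sphereDiv X x = f x := by
  obtain ⟨X₁, hX₁, hd₁⟩ := exists_sphereDiv_eq_sub_axisAverage hf
  set f₁ := axisAverage f with hf₁_def
  have hf₁ : SmoothS2 f₁ := smoothS2_axisAverage hf
  have hX₂ := isTangentField_rotField hf₁ (w := fun _ => 1) contDiff_const halfTurnMeasure_ae
  set X₂ := rotField f₁ (fun _ => 1) halfTurnMeasure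
  have hm := area_real_univ_pos.ne'
  -- With weight `1` the angle derivative integrates, from the identity to each half-turn, to the
  -- difference of the end values.
  have hd₂ : ∀ x, sphereDiv X₂ x
      = (∫ v, f₁ (dir (rot (halfTurnAxis v) Real.pi x)) ∂area) - area.real Set.univ * f₁ x := by
    intro x
    have hinner : ∀ v, ∫ s in (0 : ℝ)..Real.pi,
        deriv (fun s => f₁ (dir (rot (halfTurnAxis v) s x))) s
        = f₁ (dir (rot (halfTurnAxis v) Real.pi x)) - f₁ x := by
      intro v
      have hg := contDiff_radial_rot hf₁ (halfTurnAxis v) x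
      rw [intervalIntegral.integral_deriv_eq_sub]
      · simp [rot_zero]
      · exact fun s _ => hg.differentiable (by simp) s
      · exact (hg.continuous_deriv (by simp)).intervalIntegrable _ _
    rw [sphereDiv_rotField hf₁ contDiff_const halfTurnMeasure_ae]
    simp only [one_mul]
    rw [integral_halfTurnMeasure (continuousOn_deriv_radial_rot hf₁ x)]
    simp only [hinner]
    rw [integral_sub _ (integrable_const _), integral_const, smul_eq_mul]
    have hb := hf₁.continuous.measurable.comp (measurable_dir_halfTurn x)
    obtain ⟨C, hC⟩ := isCompact_univ.exists_bound_of_continuousOn hf₁.continuous.continuousOn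
    exact Integrable.of_bound hb.aestronglyMeasurable C
      (Eventually.of_forall fun v => hC _ (Set.mem_univ _))
  have : Nonempty S2 := ⟨pole⟩
  -- The averaged function depends on the height alone; no regularity of `G` is required.
  obtain ⟨G, hG⟩ : ∃ G : ℝ → ℝ, ∀ x : S2, f₁ x = G ((x : E3) 2) :=
    ⟨fun c => f₁ (Function.invFun (fun x : S2 => (x : E3) 2) c), fun x =>
      axisAverage_eq_of_height_eq
        (Function.invFun_eq (f := fun x : S2 => (x : E3) 2) ⟨x, rfl⟩).symm⟩
  -- The value at the half-turned point is `G ⟨v, x⟩`, whose integral over `v` does not depend on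
  -- `x`.
  have hconst : ∀ x : S2, ∫ v, f₁ (dir (rot (halfTurnAxis v) Real.pi x)) ∂area
      = ∫ v : S2, G (inner ℝ (v : E3) (pole : E3)) ∂area := by
    intro x
    rw [← integral_zonal G x pole]
    congr 1 with v
    have : dir (rot (halfTurnAxis v) Real.pi x) = rotS (halfTurnAxis v) Real.pi x := by
      rw [← dir_coe (rotS _ _ _), coe_rotS]
    rw [this, hG, coe_rotS, rot_halfTurnAxis_height]
  simp only [hconst] at hd₂
  set c := ∫ v : S2, G (inner ℝ (v : E3) (pole : E3)) ∂area
  set A := area.real Set.univ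
  have hX := hX₁.sub (hX₂.const_smul A⁻¹)
  have hd : ∀ x, sphereDiv (fun x => X₁ x - A⁻¹ • X₂ x) x = f x - A⁻¹ * c := by
    intro x
    rw [sphereDiv_sub hX₁.1 (hX₂.const_smul A⁻¹).1, sphereDiv_const_smul hX₂.1, hd₁, hd₂]
    field_simp
    ring
  -- Now `f` minus a constant is a divergence; both have mean zero, so the constant vanishes.
  have hc : A⁻¹ * c = 0 := by
    have := integral_sphereDiv hX
    simp only [hd] at this
    rw [integral_sub hf.integrable (integrable_const _), h0, integral_const, smul_eq_mul] at this
    have h3 : A * (A⁻¹ * c) = 0 := by linarith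
    exact (mul_eq_zero.1 h3).resolve_left hm
  exact ⟨_, hX, fun x => by rw [hd, hc, sub_zero]⟩

/-! ### Two-forms on the sphere -/

lemma sphereDeriv_eq_sum {F : Type*} [NormedAddCommGroup F] [NormedSpace ℝ F] (f : S2 → F)
    (x : S2) (u : E3) : sphereDeriv f x u = u 0 • sphereDeriv f x (basisVec 0)
      + u 1 • sphereDeriv f x (basisVec 1) + u 2 • sphereDeriv f x (basisVec 2) := by
  conv_lhs => rw [eq_sum_basisVec u]
  simp [sphereDeriv]

lemma smoothS2_volForm {φ : S2 → E3} (hφ : SmoothS2 φ) (u w : E3) :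
    SmoothS2 (fun x => volForm φ x u w) :=
  hφ.inner ((hφ.sphereDeriv u).cross (hφ.sphereDeriv w))

lemma smoothS2_volDensity {φ : S2 → E3} (hφ : SmoothS2 φ) : SmoothS2 (volDensity φ) :=
  SmoothS2.sum fun i _ => SmoothS2.smul (smoothS2_coe.apply i) (smoothS2_volForm hφ _ _)

lemma volForm_eq_triple (φ : S2 → E3) (x : S2) (u w : E3) :
    volForm φ x u w = triple (φ x) (sphereDeriv φ x u) (sphereDeriv φ x w) := rfl

/-- An alternating form in three dimensions is a vector of coefficients paired with `u × w`, and for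
tangent vectors `u × w` is a multiple of `x`; the remaining pairing with `x` is the density. -/
lemma volForm_eq_volDensity_mul (φ : S2 → E3) {x : S2} {u w : E3} (hu : IsTangentAt x u)
    (hw : IsTangentAt x w) : volForm φ x u w = volDensity φ x * triple x u w := by
  have hc := cross_eq_of_tangent hu hw
  have h0 := congrArg (fun v : E3 => v 0) hc
  have h1 := congrArg (fun v : E3 => v 1) hc
  have h2 := congrArg (fun v : E3 => v 2) hc
  simp only [cross_apply_zero, cross_apply_one, cross_apply_two, PiLp.smul_apply,
    smul_eq_mul] at h0 h1 h2
  have hV : volForm φ x u w = volForm φ x (basisVec 1) (basisVec 2) * (u 1 * w 2 - u 2 * w 1)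
      + volForm φ x (basisVec 2) (basisVec 0) * (u 2 * w 0 - u 0 * w 2)
      + volForm φ x (basisVec 0) (basisVec 1) * (u 0 * w 1 - u 1 * w 0) := by
    simp only [volForm_eq_triple]
    rw [sphereDeriv_eq_sum φ x u, sphereDeriv_eq_sum φ x w]
    simp only [triple_eq, PiLp.add_apply, PiLp.smul_apply, smul_eq_mul]
    ring
  rw [hV, h0, h1, h2, volDensity]
  simp only [Fin.sum_univ_three]
  simp only [show (0 : Fin 3) + 1 = 1 from rfl, show (0 : Fin 3) + 2 = 2 from rfl,
    show (1 : Fin 3) + 1 = 2 from rfl, show (1 : Fin 3) + 2 = 0 from rfl,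
    show (2 : Fin 3) + 1 = 0 from rfl, show (2 : Fin 3) + 2 = 1 from rfl]
  ring

/-- The exterior derivative of the dual one-form of a vector field. -/
lemma sphereExtDeriv_cross {X : S2 → E3} (hX : IsTangentField X) {x : S2} {u w : E3}
    (hu : IsTangentAt x u) (hw : IsTangentAt x w) :
    sphereExtDeriv (fun x => cross x (X x)) x u w = sphereDiv X x * triple x u w := by
  -- The first of the three terms vanishes because the extension has zero radial derivative; the
  -- other two are the antisymmetrized derivative of `X`.
  have htr := trace_mul_triple (fderiv ℝ (fun y : E3 => X (dir y)) x) x u w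
  have hself : fderiv ℝ (fun y : E3 => X (dir y)) x x = 0 := sphereDeriv_self hX.1 x
  -- Differentiating the factor `x` in `x × X x` leaves `-2` times this triple product of three
  -- tangent vectors.
  have htang : triple (X x) u w = 0 := by
    have h : inner ℝ (x : E3) (X x) = 0 := hX.2 x
    rw [triple, cross_eq_of_tangent hu hw, inner_smul_right, real_inner_comm, h, mul_zero]
  have hu' : inner ℝ (x : E3) u = 0 := hu
  have hw' : inner ℝ (x : E3) w = 0 := hw
  rw [sphereDiv]
  change _ = (∑ j, fderiv ℝ (fun y : E3 => X (dir y)) x (basisVec j) j) * _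
  rw [htr, hself, sphereExtDeriv, sphereDeriv_cross smoothS2_coe hX.1,
    sphereDeriv_cross smoothS2_coe hX.1, sphereDeriv_coe, sphereDeriv_coe, hu', hw']
  change inner ℝ (cross x (fderiv ℝ (fun y : E3 => X (dir y)) x u) + _) w
    - inner ℝ (cross x (fderiv ℝ (fun y : E3 => X (dir y)) x w) + _) u = _
  simp only [triple_eq] at htang ⊢
  simp [inner_E3]
  linear_combination (-2) * htang

/-- Two-forms that differ by the pull-back of the same multiple of the area form are
cohomologous. -/
theorem exists_isGaugeForm {e a : ℝ} (ha : 0 < a) {m : ℤ} {φ φ' : S2 → E3}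
    (hφ : IsVacuum a m φ) (hφ' : IsVacuum a m φ') :
    ∃ Agau : S2 → E3, IsTangentField Agau ∧ IsGaugeForm e a φ φ' Agau := by
  have hs := smoothS2_volDensity hφ.smooth
  have hs' := smoothS2_volDensity hφ'.smooth
  have hint : ∫ x, volDensity φ x ∂area = ∫ x, volDensity φ' x ∂area := by
    have h := hφ.charge_eq.trans hφ'.charge_eq.symm
    refine mul_left_cancel₀ (inv_ne_zero ?_) h
    have := Real.pi_pos
    positivity
  obtain ⟨X, hX, hd⟩ := exists_sphereDiv_eq ((hs.sub hs').const_smul (e * a ^ 4)⁻¹) (by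
    simp only [smul_eq_mul]
    rw [integral_const_mul, integral_sub hs.integrable hs'.integrable, hint, sub_self, mul_zero])
  refine ⟨fun x => cross x (X x), ⟨smoothS2_coe.cross hX.1, fun x => ?_⟩, fun x u w hu hw => ?_⟩
  · rw [IsTangentAt, inner_E3]; simp; ring
  · rw [sphereExtDeriv_cross hX hu hw, hd, volForm_eq_volDensity_mul φ hu hw,
      volForm_eq_volDensity_mul φ' hu hw, smul_eq_mul]
    ring

/-! ### Closed one-forms on the sphere are exact -/

/-- The radial extension of a one-form on the sphere to a one-form on space. -/
def radialForm (α : S2 → E3) (y : E3) : E3 →L[ℝ] ℝ := ‖y‖⁻¹ • innerSL ℝ (α (dir y))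

lemma contDiffOn_radialForm {α : S2 → E3} (hα : SmoothS2 α) :
    ContDiffOn ℝ ∞ (radialForm α) {0}ᶜ := by
  refine ContDiffOn.fun_smul (ContDiffOn.inv ?_ fun y hy => norm_ne_zero_iff.2 hy) ?_
  · intro y hy
    exact (contDiffAt_norm ℝ hy).contDiffWithinAt
  · exact (innerSL ℝ (E := E3)).contDiff.comp_contDiffOn hα

lemma radialForm_self {α : S2 → E3} (hα : IsTangentField α) (y : E3) : radialForm α y y = 0 := by
  have := inner_dir_eq_zero (hα.2 (dir y))
  simp [radialForm, real_inner_comm, this]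

lemma radialForm_smul (α : S2 → E3) {c : ℝ} (hc : 0 < c) (y : E3) :
    radialForm α (c • y) = c⁻¹ • radialForm α y := by
  rw [radialForm, radialForm, dir_smul hc, norm_smul, Real.norm_of_nonneg hc.le, mul_inv, mul_smul]

/-- Obtained by differentiating the identity `radialForm α y y = 0`. -/
lemma fderiv_radialForm_apply_self {α : S2 → E3} (hα : IsTangentField α) {y : E3} (hy : y ≠ 0)
    (u : E3) : fderiv ℝ (radialForm α) y u y = - radialForm α y u := by
  have hd : HasFDerivAt (radialForm α) (fderiv ℝ (radialForm α) y) y :=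
    (((contDiffOn_radialForm hα.1).contDiffAt (isOpen_ne_zero.mem_nhds hy)).differentiableAt
      (by simp)).hasFDerivAt
  have h1 := hd.clm_apply (hasFDerivAt_id y)
  have h2 : HasFDerivAt (fun y => radialForm α y (id y)) (0 : E3 →L[ℝ] ℝ) y := by
    simp only [id, radialForm_self hα]
    exact hasFDerivAt_const _ _
  have h3 := congrArg (fun L : E3 →L[ℝ] ℝ => L u) (h1.unique h2)
  simp at h3
  linarith

/-- Euler's relation in degree `-1`. -/
lemma fderiv_radialForm_self {α : S2 → E3} (hα : IsTangentField α) {y : E3} (hy : y ≠ 0) :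
    fderiv ℝ (radialForm α) y y = - radialForm α y := by
  have hd : HasFDerivAt (radialForm α) (fderiv ℝ (radialForm α) y) ((1 : ℝ) • y) := by
    rw [one_smul]
    exact (((contDiffOn_radialForm hα.1).contDiffAt (isOpen_ne_zero.mem_nhds hy)).differentiableAt
      (by simp)).hasFDerivAt
  have h1 : HasDerivAt (fun t : ℝ => t • y) y 1 := by
    simpa using (hasDerivAt_id (1 : ℝ)).smul_const y
  have h2 := hd.comp_hasDerivAt (1 : ℝ) h1
  have h3 : HasDerivAt (radialForm α ∘ fun t : ℝ => t • y) (-radialForm α y) 1 := by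
    have h4 := (hasDerivAt_inv (one_ne_zero (α := ℝ))).smul_const (radialForm α y)
    simp only [one_pow, inv_one, neg_smul, one_smul] at h4
    refine h4.congr_of_eventuallyEq ?_
    filter_upwards [lt_mem_nhds (zero_lt_one (α := ℝ))] with t ht
    simp [radialForm_smul α ht]
  exact h2.unique h3

/-- A closed one-form on the sphere. -/
def IsClosedForm (α : S2 → E3) : Prop :=
  ∀ x u w, IsTangentAt x u → IsTangentAt x w → sphereExtDeriv α x u w = 0

lemma fderiv_radialForm_tangent {α : S2 → E3} (hα : IsTangentField α) {x : S2} {u : E3}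
    (hu : IsTangentAt x u) (w : E3) :
    fderiv ℝ (radialForm α) x u w = inner ℝ (sphereDeriv α x u) w := by
  have hn := hasFDerivAt_norm_S2 x
  have h2 := ((hasDerivAt_inv (norm_ne_zero_iff.2 (S2_ne_zero x))).comp_hasFDerivAt (x : E3) hn)
  have h3 : HasFDerivAt (fun y : E3 => innerSL ℝ (α (dir y))) _ (x : E3) :=
    (innerSL ℝ (E := E3)).hasFDerivAt.comp (x : E3) (hα.1.hasFDerivAt x)
  have h4 : HasFDerivAt (radialForm α) _ (x : E3) := h2.smul h3
  rw [h4.fderiv]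
  have hu' : inner ℝ (x : E3) u = 0 := hu
  simp [hu', sphereDeriv]
  rfl

/-- For tangential `α` the radial form is the pull-back of `α` under `dir`, so it inherits
closedness. Concretely, two tangential arguments are covered by the hypothesis, and for one radial
argument both orders give `- radialForm α y u`. -/
lemma fderiv_radialForm_symm {α : S2 → E3} (hα : IsTangentField α) (hc : IsClosedForm α)
    {y : E3} (hy : y ≠ 0) (u w : E3) :
    fderiv ℝ (radialForm α) y u w = fderiv ℝ (radialForm α) y w u := by
  -- reduction to the unit sphere
  have hscale : ∀ c : ℝ, 0 < c → ∀ z : E3, z ≠ 0 →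
      fderiv ℝ (radialForm α) (c • z) = (c⁻¹ * c⁻¹) • fderiv ℝ (radialForm α) z := by
    intro c hc z hz
    have h1 := fderiv_comp_smul (𝕜 := ℝ) (f := radialForm α) (x := z) c
    have h2 : (fun z => radialForm α (c • z)) = fun z => c⁻¹ • radialForm α z := by
      ext1 z; exact radialForm_smul α hc z
    have hd : DifferentiableAt ℝ (radialForm α) z :=
      ((contDiffOn_radialForm hα.1).contDiffAt (isOpen_ne_zero.mem_nhds hz)).differentiableAt
        (by simp)
    rw [h2, (hd.hasFDerivAt.fun_const_smul c⁻¹).fderiv] at h1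
    rw [mul_smul, h1, smul_smul, inv_mul_cancel₀ hc.ne', one_smul]
  have hsphere : ∀ (x : S2) (u w : E3),
      fderiv ℝ (radialForm α) x u w = fderiv ℝ (radialForm α) x w u := by
    intro x u w
    have hx := S2_ne_zero x
    have hdec : ∀ v : E3, ∃ t : E3, ∃ c : ℝ, IsTangentAt x t ∧ v = t + c • (x : E3) := by
      intro v
      refine ⟨v - (inner ℝ (x : E3) v) • (x : E3), inner ℝ (x : E3) v, ?_, by simp⟩
      rw [IsTangentAt, inner_sub_right, inner_smul_right, real_inner_self_eq_norm_sq, norm_S2]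
      ring
    obtain ⟨u', a, hu, rfl⟩ := hdec u
    obtain ⟨w', b, hw, rfl⟩ := hdec w
    have h1 := hc x u' w' hu hw
    rw [sphereExtDeriv] at h1
    simp only [map_add, map_smul, add_apply, smul_apply,
      fderiv_radialForm_apply_self hα hx, fderiv_radialForm_self hα hx,
      neg_apply, radialForm_self hα, fderiv_radialForm_tangent hα hu w',
      fderiv_radialForm_tangent hα hw u', smul_eq_mul]
    linarith
  have h := hscale ‖y‖ (norm_pos_iff.2 hy) (dir y) (S2_ne_zero _)
  rw [norm_smul_dir] at h
  rw [h]
  simp only [smul_apply, hsphere (dir y) u w]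

/-! ### Primitives on star-shaped sets and on punctured space -/

/-- The Poincaré lemma for one-forms on star-shaped open sets. -/
theorem exists_primitive_of_starShaped {θ : E3 → E3 →L[ℝ] ℝ} {U : Set E3} (hU : IsOpen U)
    (hθ : ContDiffOn ℝ ∞ θ U) (hsymm : ∀ y ∈ U, ∀ u w, fderiv ℝ θ y u w = fderiv ℝ θ y w u)
    (c : E3) (hstar : ∀ y ∈ U, ∀ t ∈ Set.Icc (0 : ℝ) 1, c + t • (y - c) ∈ U) :
    ∃ ψ : E3 → ℝ, ∀ y ∈ U, HasFDerivAt ψ (θ y) y := by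
  let ν : Measure ℝ := volume.restrict (Set.Icc 0 1)
  let F : E3 × ℝ → ℝ := fun q => θ (c + q.2 • (q.1 - c)) (q.1 - c)
  let W : Set (E3 × ℝ) := {q | c + q.2 • (q.1 - c) ∈ U}
  have hν : ∀ᵐ t ∂ν, t ∈ Set.Icc (0 : ℝ) 1 := ae_restrict_mem measurableSet_Icc
  have hline : ContDiff ℝ ∞ (fun q : E3 × ℝ => c + q.2 • (q.1 - c)) := by fun_prop
  have hW : IsOpen W := hU.preimage hline.continuous
  have hUW : U ×ˢ Set.Icc (0 : ℝ) 1 ⊆ W := fun q hq => hstar q.1 hq.1 q.2 hq.2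
  have hF : ContDiffOn ℝ ∞ F W :=
    (ContDiffOn.comp (g := θ) hθ hline.contDiffOn fun _ hq => hq).clm_apply (by fun_prop)
  refine ⟨fun y => ∫ t, F (y, t) ∂ν, fun y hy => ?_⟩
  refine (hasFDerivAt_integral_of_compact isCompact_Icc hν hU hW hUW
    (hF.of_le (by simp)) hy).congr_fderiv ?_
  have hcont : ContinuousOn (fun t : ℝ => (fderiv ℝ F (y, t)).comp
      (ContinuousLinearMap.inl ℝ E3 ℝ)) (Set.Icc 0 1) := by
    refine ContinuousOn.clm_comp ?_ continuousOn_const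
    exact (hF.continuousOn_fderiv_of_isOpen hW (by simp)).comp (f := fun t => (y, t))
      (by fun_prop) fun t ht => hUW ⟨hy, ht⟩
  ext u
  rw [ContinuousLinearMap.integral_apply
    (integrable_of_continuousOn_of_ae_mem isCompact_Icc hν hcont)]
  -- By symmetry of the derivative of `θ`, the `u`-derivative of the integrand is the total
  -- `t`-derivative of `t θ(c + t(y - c)) u`, whose increment from `0` to `1` is `θ y u`.
  have hftc : ∀ t ∈ Set.uIcc (0 : ℝ) 1, HasDerivAt (fun t : ℝ => t * θ (c + t • (y - c)) u)
      ((fderiv ℝ F (y, t)).comp (ContinuousLinearMap.inl ℝ E3 ℝ) u) t := by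
    intro t ht
    rw [Set.uIcc_of_le zero_le_one] at ht
    have hmem := hstar y hy t ht
    have hd := ((hθ.contDiffAt (hU.mem_nhds hmem)).differentiableAt (by simp)).hasFDerivAt
    have h1 : HasDerivAt (fun t : ℝ => c + t • (y - c)) (y - c) t := by
      simpa using ((hasDerivAt_id t).smul_const (y - c)).const_add c
    have h20 : HasDerivAt (fun t : ℝ => θ (c + t • (y - c)))
        (fderiv ℝ θ (c + t • (y - c)) (y - c)) t := hd.comp_hasDerivAt t h1
    have h21 : HasDerivAt (fun t : ℝ => θ (c + t • (y - c)) u)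
        (fderiv ℝ θ (c + t • (y - c)) (y - c) u) t :=
      (ContinuousLinearMap.apply ℝ ℝ u).hasFDerivAt.comp_hasDerivAt t h20
    have h2 : HasDerivAt (fun t : ℝ => t * θ (c + t • (y - c)) u) _ t :=
      (hasDerivAt_id t).mul h21
    refine h2.congr_deriv ?_
    have h3 : HasFDerivAt (fun y : E3 => c + t • (y - c)) (t • ContinuousLinearMap.id ℝ E3) y :=
      (((hasFDerivAt_id y).sub_const c).const_smul t).const_add c
    have h40 : HasFDerivAt (fun y : E3 => θ (c + t • (y - c))) _ y :=
      HasFDerivAt.comp (g := θ) y hd h3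
    have h4 : HasFDerivAt (fun y : E3 => F (y, t)) _ y :=
      h40.clm_apply ((hasFDerivAt_id y).sub_const c)
    have h5 : HasFDerivAt (fun y : E3 => F (y, t)) _ y :=
      HasFDerivAt.comp (g := F) y (((hF.contDiffAt (hW.mem_nhds (hUW (Set.mk_mem_prod hy
        ht)))).differentiableAt (by simp)).hasFDerivAt) (hasFDerivAt_prodMk_left y t)
    have h6 := congrArg (fun L : E3 →L[ℝ] ℝ => L u) (h5.unique h4)
    simp only at h6
    rw [h6]
    simp [hsymm _ hmem u]
  have hint : IntervalIntegrable (fun t : ℝ => (fderiv ℝ F (y, t)).comp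
      (ContinuousLinearMap.inl ℝ E3 ℝ) u) volume 0 1 := by
    rw [intervalIntegrable_iff_integrableOn_Icc_of_le zero_le_one]
    exact (hcont.clm_apply continuousOn_const).integrableOn_Icc
  have h := intervalIntegral.integral_eq_sub_of_hasDerivAt hftc hint
  rw [intervalIntegral.integral_of_le zero_le_one, ← integral_Icc_eq_integral_Ioc] at h
  refine h.trans ?_
  simp

/-- Space without a vertical half-line. -/
def slitSpace (σ : ℝ) : Set E3 := {y | ¬ (y 0 = 0 ∧ y 1 = 0 ∧ 0 ≤ σ * y 2)}

lemma isOpen_slitSpace (σ : ℝ) : IsOpen (slitSpace σ) := by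
  have h : slitSpace σ = ({y : E3 | y 0 = 0} ∩ ({y | y 1 = 0} ∩ {y | 0 ≤ σ * y 2}))ᶜ := rfl
  rw [h, isOpen_compl_iff]
  have hc : ∀ i : Fin 3, Continuous fun y : E3 => y i := fun i => (coordL i).continuous
  exact (isClosed_eq (hc 0) continuous_const).inter ((isClosed_eq (hc 1) continuous_const).inter
    (isClosed_le continuous_const (continuous_const.mul (hc 2))))

lemma slitSpace_subset (σ : ℝ) : slitSpace σ ⊆ {0}ᶜ := by
  intro y hy h0
  apply hy
  rw [Set.mem_singleton_iff] at h0
  simp [h0]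

/-- The centre lies on the half of the axis that is kept. If a point of the segment other than the
centre meets the removed half-line, then so does the end point `y`. -/
lemma slitSpace_starShaped {σ : ℝ} (hσ : σ * σ = 1) :
    ∀ y ∈ slitSpace σ, ∀ t ∈ Set.Icc (0 : ℝ) 1,
      (-σ) • basisVec 2 + t • (y - (-σ) • basisVec 2) ∈ slitSpace σ := by
  rintro y hy t ⟨ht0, ht1⟩ ⟨h0, h1, h2⟩
  simp at h0 h1 h2
  have ht : t ≠ 0 := by
    rintro rfl
    nlinarith
  apply hy
  refine ⟨h0.resolve_left ht, h1.resolve_left ht, ?_⟩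
  have hpos : 0 < t := lt_of_le_of_ne ht0 (Ne.symm ht)
  by_contra hneg
  push Not at hneg
  nlinarith [mul_pos hpos (neg_pos.2 hneg)]

lemma inter_slitSpace : slitSpace 1 ∩ slitSpace (-1) = (Submodule.span ℝ {basisVec 2} : Set E3)ᶜ := by
  ext y
  simp only [slitSpace, Set.mem_inter_iff, Set.mem_ofPred_eq, Set.mem_compl_iff, SetLike.mem_coe,
    Submodule.mem_span_singleton]
  constructor
  · rintro ⟨h1, h2⟩ ⟨c, rfl⟩
    rcases le_total 0 c with h | h
    · apply h1; simpa using h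
    · apply h2; simpa using h
  · intro h
    constructor <;>
    · rintro ⟨h0, h1, -⟩
      exact h ⟨y 2, by apply ext_E3 <;> simp [h0, h1]⟩

/-- A line has codimension two in space, so its complement is connected. This is what makes two
primitives on the overlap differ by one constant only. -/
lemma isPreconnected_inter_slitSpace : IsPreconnected (slitSpace 1 ∩ slitSpace (-1)) := by
  rw [inter_slitSpace]
  refine (isConnected_compl_of_one_lt_codim ?_).isPreconnected
  have h := Submodule.finrank_quotient_add_finrank (Submodule.span ℝ {basisVec 2})
  rw [finrank_span_singleton (by
    intro h
    have := congrArg (fun u : E3 => u 2) h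
    simp at this), finrank_euclideanSpace_fin] at h
  rw [← Module.finrank_eq_rank]
  have h2 : Module.finrank ℝ (E3 ⧸ Submodule.span ℝ {basisVec 2}) = 2 := by omega
  rw [h2]
  norm_num

lemma union_slitSpace {y : E3} (hy : y ≠ 0) (h : y ∉ slitSpace 1) : y ∈ slitSpace (-1) := by
  simp only [slitSpace, Set.mem_ofPred_eq, not_not] at h ⊢
  rintro ⟨-, -, h3⟩
  exact hy (ext_E3 h.1 h.2.1 (by simp; linarith [h.2.2]))

/-- A closed one-form on punctured space is exact. -/
theorem exists_primitive_punctured {θ : E3 → E3 →L[ℝ] ℝ} (hθ : ContDiffOn ℝ ∞ θ {0}ᶜ)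
    (hsymm : ∀ y ≠ 0, ∀ u w, fderiv ℝ θ y u w = fderiv ℝ θ y w u) :
    ∃ ψ : E3 → ℝ, ∀ y ≠ 0, HasFDerivAt ψ (θ y) y := by
  classical
  have hex : ∀ σ : ℝ, σ * σ = 1 → ∃ ψ : E3 → ℝ, ∀ y ∈ slitSpace σ, HasFDerivAt ψ (θ y) y :=
    fun σ hσ => exists_primitive_of_starShaped (isOpen_slitSpace σ)
      (hθ.mono (slitSpace_subset σ)) (fun y hy => hsymm y (slitSpace_subset σ hy)) _
      (slitSpace_starShaped hσ)
  obtain ⟨ψ, hψ⟩ := hex 1 (by norm_num)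
  obtain ⟨χ, hχ⟩ := hex (-1) (by norm_num)
  have hdiff : ∀ y ∈ slitSpace 1 ∩ slitSpace (-1), HasFDerivAt (fun y => ψ y - χ y) 0 y :=
    fun y hy => by simpa using (hψ y hy.1).fun_sub (hχ y hy.2)
  have hb : basisVec 0 ∈ slitSpace 1 ∩ slitSpace (-1) := by
    simp [slitSpace]
  have hconst : ∀ y ∈ slitSpace 1 ∩ slitSpace (-1),
      ψ y - χ y = ψ (basisVec 0) - χ (basisVec 0) := fun y hy =>
    ((isOpen_slitSpace 1).inter (isOpen_slitSpace (-1))).is_const_of_fderiv_eq_zero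
      isPreconnected_inter_slitSpace
      (fun y hy => (hdiff y hy).differentiableAt.differentiableWithinAt)
      (fun y hy => (hdiff y hy).fderiv) hy hb
  -- The second primitive is shifted by its constant difference from the first, so that the two
  -- agree on the overlap.
  refine ⟨fun y => if y ∈ slitSpace 1 then ψ y else
    χ y + (ψ (basisVec 0) - χ (basisVec 0)), fun y hy => ?_⟩
  by_cases h : y ∈ slitSpace 1
  · refine (hψ y h).congr_of_eventuallyEq ?_
    filter_upwards [(isOpen_slitSpace 1).mem_nhds h] with z hz
    simp [hz]
  · have h' := union_slitSpace hy h
    refine ((hχ y h').add_const (ψ (basisVec 0) - χ (basisVec 0))).congr_of_eventuallyEq ?_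
    filter_upwards [(isOpen_slitSpace (-1)).mem_nhds h'] with z hz
    by_cases hz1 : z ∈ slitSpace 1
    · simp only [hz1, if_true]
      linarith [hconst z ⟨hz1, hz⟩]
    · simp [hz1]

/-- A closed one-form on the sphere is exact. -/
theorem exists_sphereGrad_eq {α : S2 → E3} (hα : IsTangentField α) (hc : IsClosedForm α) :
    ∃ ψ : S2 → ℝ, SmoothS2 ψ ∧ ∀ x u, sphereDeriv ψ x u = inner ℝ (α x) u := by
  obtain ⟨Ψ, hΨ⟩ := exists_primitive_punctured (contDiffOn_radialForm hα.1)
    fun y hy => fderiv_radialForm_symm hα hc hy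
  -- The form annihilates the radial direction, so its primitive is constant on rays and is the
  -- radial extension of its restriction to the sphere.
  have hrad : ∀ y : E3, y ≠ 0 → Ψ (dir y) = Ψ y := by
    intro y hy
    have hd : ∀ t ∈ Set.Ioi (0 : ℝ), HasDerivAt (fun t : ℝ => Ψ (t • y)) 0 t := by
      intro t ht
      have h1 : HasDerivAt (fun t : ℝ => t • y) y t := by
        simpa using (hasDerivAt_id t).smul_const y
      have h2 := (hΨ (t • y) (smul_ne_zero (ne_of_gt ht) hy)).comp_hasDerivAt t h1
      refine h2.congr_deriv ?_
      rw [radialForm_smul α ht]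
      simp [radialForm_self hα]
    obtain ⟨b, hb⟩ := isOpen_Ioi.exists_is_const_of_deriv_eq_zero isPreconnected_Ioi
      (fun t ht => (hd t ht).differentiableAt.differentiableWithinAt)
      (fun t ht => (hd t ht).deriv)
    have h := (hb ‖y‖⁻¹ (inv_pos.2 (norm_pos_iff.2 hy))).trans (hb 1 (Set.mem_Ioi.2 one_pos)).symm
    simpa [dir_of_ne hy] using h
  refine ⟨fun x => Ψ x, ?_, ?_⟩
  · have h : ContDiffOn ℝ ∞ Ψ {0}ᶜ := by
      rw [contDiffOn_infty_iff_fderiv_of_isOpen isOpen_ne_zero]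
      exact ⟨fun y hy => (hΨ y hy).differentiableAt.differentiableWithinAt,
        (contDiffOn_radialForm hα.1).congr fun y hy => (hΨ y hy).fderiv⟩
    exact h.congr fun y hy => hrad y hy
  · intro x u
    have hx := S2_ne_zero x
    have hloc : (fun y : E3 => Ψ (dir y)) =ᶠ[𝓝 (x : E3)] Ψ := by
      filter_upwards [isOpen_ne_zero.mem_nhds hx] with y hy
      exact hrad y hy
    rw [sphereDeriv, hloc.fderiv_eq, (hΨ x hx).fderiv]
    simp [radialForm]

/-- A vector field without divergence is orthogonal to closed one-forms. -/
theorem integral_inner_closed_eq_zero {X α : S2 → E3} (hX : IsTangentField X)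
    (hdiv : ∀ x, sphereDiv X x = 0) (hα : IsTangentField α) (hc : IsClosedForm α) :
    ∫ x, inner ℝ (X x) (α x) ∂area = 0 := by
  obtain ⟨ψ, hψ, hd⟩ := exists_sphereGrad_eq hα hc
  have hT : IsTangentField (fun x => ψ x • X x) :=
    ⟨hψ.smul hX.1, fun x => by
      have := hX.2 x
      unfold IsTangentAt at *
      rw [inner_smul_right, this, mul_zero]⟩
  -- Since `X` is divergence-free, the divergence of `ψ X` is `dψ(X)`, the scalar product of `α` and
  -- `X`.
  rw [← integral_sphereDiv hT]
  congr 1 with x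
  rw [sphereDiv_smul hψ hX.1, hdiv, hd, real_inner_comm]
  ring

/-! ### Families of functions on the sphere -/

section Family

variable {F : Type*} [NormedAddCommGroup F] [NormedSpace ℝ F] {c : ℝ → S2 → F}

lemma isOpen_familyDomain : IsOpen (Set.univ ×ˢ {0}ᶜ : Set (ℝ × E3)) :=
  isOpen_univ.prod isOpen_ne_zero

lemma SmoothFamilyS2.contDiffAt (hc : SmoothFamilyS2 c) (s : ℝ) {y : E3} (hy : y ≠ 0) :
    ContDiffAt ℝ ∞ (fun p : ℝ × E3 => c p.1 (dir p.2)) (s, y) :=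
  ContDiffOn.contDiffAt hc (isOpen_familyDomain.mem_nhds ⟨Set.mem_univ _, hy⟩)

lemma SmoothFamilyS2.hasFDerivAt (hc : SmoothFamilyS2 c) (s : ℝ) {y : E3} (hy : y ≠ 0) :
    HasFDerivAt (fun p : ℝ × E3 => c p.1 (dir p.2))
      (fderiv ℝ (fun p : ℝ × E3 => c p.1 (dir p.2)) (s, y)) (s, y) :=
  ((hc.contDiffAt s hy).differentiableAt (by simp)).hasFDerivAt

lemma SmoothFamilyS2.smoothS2 (hc : SmoothFamilyS2 c) (s : ℝ) : SmoothS2 (c s) :=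
  ContDiffOn.comp (g := fun p : ℝ × E3 => c p.1 (dir p.2)) (f := fun y : E3 => (s, y)) hc
    (by fun_prop) fun _ hy => ⟨Set.mem_univ _, hy⟩

lemma SmoothFamilyS2.hasDerivAt_fderiv (hc : SmoothFamilyS2 c) (s : ℝ) {y : E3} (hy : y ≠ 0) :
    HasDerivAt (fun t => c t (dir y))
      (fderiv ℝ (fun p : ℝ × E3 => c p.1 (dir p.2)) (s, y) (1, 0)) s :=
  HasFDerivAt.comp_hasDerivAt (f := fun t : ℝ => (t, y)) s (hc.hasFDerivAt s hy)
    ((hasDerivAt_id s).prodMk (hasDerivAt_const s y))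

lemma SmoothFamilyS2.hasDerivAt (hc : SmoothFamilyS2 c) (s : ℝ) (x : S2) :
    HasDerivAt (fun t => c t x) (deriv (fun t => c t x) s) s := by
  have h := hc.hasDerivAt_fderiv s (S2_ne_zero x)
  rw [dir_coe] at h
  exact h.differentiableAt.hasDerivAt

lemma SmoothFamilyS2.fderiv_slice (hc : SmoothFamilyS2 c) (s : ℝ) {y : E3} (hy : y ≠ 0) (u : E3) :
    fderiv ℝ (fun y : E3 => c s (dir y)) y u
      = fderiv ℝ (fun p : ℝ × E3 => c p.1 (dir p.2)) (s, y) (0, u) := by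
  have h : HasFDerivAt (fun y : E3 => c s (dir y)) _ y :=
    HasFDerivAt.comp (f := fun y : E3 => (s, y)) y (hc.hasFDerivAt s hy)
      (hasFDerivAt_prodMk_right s y)
  rw [h.fderiv]
  simp

lemma SmoothFamilyS2.smoothS2_deriv (hc : SmoothFamilyS2 c) (s : ℝ) :
    SmoothS2 (fun x => deriv (fun t => c t x) s) := by
  have h : ContDiffOn ℝ ∞ (fun y : E3 =>
      fderiv ℝ (fun p : ℝ × E3 => c p.1 (dir p.2)) (s, y) (1, 0)) {0}ᶜ := by
    refine ContDiffOn.clm_apply ?_ contDiffOn_const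
    exact ContDiffOn.comp (g := fderiv ℝ (fun p : ℝ × E3 => c p.1 (dir p.2)))
      (f := fun y : E3 => (s, y)) (ContDiffOn.fderiv_of_isOpen hc isOpen_familyDomain (by simp))
      (by fun_prop) fun _ hy => ⟨Set.mem_univ _, hy⟩
  exact h.congr fun y hy => (hc.hasDerivAt_fderiv s hy).deriv

/-- Differentiation along the sphere commutes with differentiation in the parameter. -/
lemma SmoothFamilyS2.hasDerivAt_sphereDeriv (hc : SmoothFamilyS2 c) (s : ℝ) (x : S2) (u : E3) :
    HasDerivAt (fun t => sphereDeriv (c t) x u)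
      (sphereDeriv (fun x => deriv (fun t => c t x) s) x u) s := by
  have hx := S2_ne_zero x
  set D := fderiv ℝ (fun p : ℝ × E3 => c p.1 (dir p.2)) with hD
  have hD' : HasFDerivAt D (fderiv ℝ D (s, (x : E3))) (s, (x : E3)) :=
    (((hc.contDiffAt s hx).fderiv_right (m := 1) (by norm_cast)).differentiableAt
      one_ne_zero).hasFDerivAt
  have h1 : HasDerivAt (fun t : ℝ => D (t, (x : E3))) (fderiv ℝ D (s, (x : E3)) (1, 0)) s :=
    HasFDerivAt.comp_hasDerivAt (f := fun t : ℝ => (t, (x : E3))) s hD'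
      ((hasDerivAt_id s).prodMk (hasDerivAt_const s (x : E3)))
  have h2 : HasDerivAt (fun t : ℝ => D (t, (x : E3)) (0, u))
      (fderiv ℝ D (s, (x : E3)) (1, 0) (0, u)) s :=
    (ContinuousLinearMap.apply ℝ F ((0, u) : ℝ × E3)).hasFDerivAt.comp_hasDerivAt s h1
  have h3 : HasFDerivAt (fun y : E3 => D (s, y))
      ((fderiv ℝ D (s, (x : E3))).comp (ContinuousLinearMap.inr ℝ ℝ E3)) (x : E3) :=
    HasFDerivAt.comp (f := fun y : E3 => (s, y)) (x : E3) hD' (hasFDerivAt_prodMk_right s (x : E3))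
  have h4 : HasFDerivAt (fun y : E3 => D (s, y) (1, 0)) _ (x : E3) :=
    (ContinuousLinearMap.apply ℝ F ((1, 0) : ℝ × E3)).hasFDerivAt.comp (x : E3) h3
  have h5 : (fun y : E3 => deriv (fun t => c t (dir y)) s) =ᶠ[𝓝 (x : E3)]
      fun y => D (s, y) (1, 0) := by
    filter_upwards [isOpen_ne_zero.mem_nhds hx] with y hy
    exact (hc.hasDerivAt_fderiv s hy).deriv
  have h6 : sphereDeriv (fun x => deriv (fun t => c t x) s) x u
      = fderiv ℝ D (s, (x : E3)) (0, u) (1, 0) := by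
    rw [sphereDeriv, h5.fderiv_eq, h4.fderiv]
    simp
  -- Symmetry of the second derivative of the jointly smooth extension exchanges the parameter
  -- direction and `u`.
  have h7 : fderiv ℝ D (s, (x : E3)) (0, u) (1, 0) = fderiv ℝ D (s, (x : E3)) (1, 0) (0, u) :=
    ((hc.contDiffAt s hx).isSymmSndFDerivAt (by simpa using ENat.LEInfty.out)).eq _ _
  rw [h6, h7]
  have h8 : (fun t => sphereDeriv (c t) x u) = fun t => D (t, (x : E3)) (0, u) := by
    ext1 t
    exact hc.fderiv_slice t hx u
  rwa [h8]

end Family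

/-! ### Variation of the pulled-back volume form -/

/-- Three vectors in one plane are linearly dependent. In formulas, `triple u v w • p` is the
combination of `v × w`, `w × u`, `u × v` with coefficients `⟨p, u⟩`, `⟨p, v⟩`, `⟨p, w⟩`. -/
lemma triple_eq_zero_of_orthogonal {p u v w : E3} (hp : p ≠ 0) (hu : inner ℝ p u = 0)
    (hv : inner ℝ p v = 0) (hw : inner ℝ p w = 0) : triple u v w = 0 := by
  rw [inner_E3] at hu hv hw
  have key : triple u v w • p = 0 := by
    rw [triple_eq]
    apply ext_E3
    · simp only [PiLp.smul_apply, PiLp.zero_apply, smul_eq_mul]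
      linear_combination (v 1 * w 2 - v 2 * w 1) * hu + (w 1 * u 2 - w 2 * u 1) * hv
        + (u 1 * v 2 - u 2 * v 1) * hw
    · simp only [PiLp.smul_apply, PiLp.zero_apply, smul_eq_mul]
      linear_combination (v 2 * w 0 - v 0 * w 2) * hu + (w 2 * u 0 - w 0 * u 2) * hv
        + (u 2 * v 0 - u 0 * v 2) * hw
    · simp only [PiLp.smul_apply, PiLp.zero_apply, smul_eq_mul]
      linear_combination (v 0 * w 1 - v 1 * w 0) * hu + (w 0 * u 1 - w 1 * u 0) * hv
        + (u 0 * v 1 - u 1 * v 0) * hw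
  exact (smul_eq_zero.1 key).resolve_right hp

/-- The one-form `φ · (ψ × ∂φ)`. -/
def variationForm (φ ψ : S2 → E3) (x : S2) : E3 :=
  WithLp.toLp 2 (fun j => triple (φ x) (ψ x) (sphereDeriv φ x (basisVec j)))

lemma inner_variationForm (φ ψ : S2 → E3) (x : S2) (w : E3) :
    inner ℝ (variationForm φ ψ x) w = triple (φ x) (ψ x) (sphereDeriv φ x w) := by
  rw [sphereDeriv_eq_sum φ x w, inner_E3]
  simp only [variationForm, triple_eq, PiLp.add_apply, PiLp.smul_apply, smul_eq_mul]
  ring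

lemma smoothS2_variationForm {φ ψ : S2 → E3} (hφ : SmoothS2 φ) (hψ : SmoothS2 ψ) :
    SmoothS2 (variationForm φ ψ) :=
  SmoothS2.toLp fun j => hφ.inner (hψ.cross (hφ.sphereDeriv (basisVec j)))

lemma isTangentField_variationForm {φ ψ : S2 → E3} (hφ : SmoothS2 φ) (hψ : SmoothS2 ψ) :
    IsTangentField (variationForm φ ψ) := by
  refine ⟨smoothS2_variationForm hφ hψ, fun x => ?_⟩
  rw [IsTangentAt, real_inner_comm, inner_variationForm, sphereDeriv_self hφ]
  simp [triple_eq]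

lemma inner_sphereDeriv {α : S2 → E3} (hα : SmoothS2 α) (x : S2) (u w : E3) :
    inner ℝ (sphereDeriv α x u) w = sphereDeriv (fun x => inner ℝ (α x) w) x u := by
  rw [sphereDeriv_inner hα (smoothS2_const w)]
  have : sphereDeriv (fun _ : S2 => w) x u = 0 := by simp [sphereDeriv]
  simp [this]

/-- The second derivatives of `φ` cancel on antisymmetrization. The first two terms already occur in
the variation of `Vol_φ` in the direction `ψ`. -/
lemma sphereExtDeriv_variationForm {φ ψ : S2 → E3} (hφ : SmoothS2 φ) (hψ : SmoothS2 ψ)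
    (x : S2) {u w : E3} (hu : IsTangentAt x u) (hw : IsTangentAt x w) :
    sphereExtDeriv (variationForm φ ψ) x u w
      = triple (φ x) (sphereDeriv ψ x u) (sphereDeriv φ x w)
        + triple (φ x) (sphereDeriv φ x u) (sphereDeriv ψ x w)
        - 2 * triple (ψ x) (sphereDeriv φ x u) (sphereDeriv φ x w) := by
  have h : ∀ u w : E3, inner ℝ (sphereDeriv (variationForm φ ψ) x u) w
      = triple (φ x) (ψ x) (sphereDeriv (fun x => sphereDeriv φ x w) x u)
        + triple (φ x) (sphereDeriv ψ x u) (sphereDeriv φ x w)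
        + triple (sphereDeriv φ x u) (ψ x) (sphereDeriv φ x w) := by
    intro u w
    rw [inner_sphereDeriv (smoothS2_variationForm hφ hψ)]
    simp only [inner_variationForm]
    simp only [triple]
    rw [sphereDeriv_inner hφ (hψ.cross (hφ.sphereDeriv w)),
      sphereDeriv_cross hψ (hφ.sphereDeriv w), inner_add_right]
  rw [sphereExtDeriv, h, h, sphereDeriv_comm hφ hu hw]
  simp only [triple_eq]
  ring

lemma hasDerivAt_triple {f g h : ℝ → E3} {f' g' h' : E3} {s : ℝ} (hf : HasDerivAt f f' s)
    (hg : HasDerivAt g g' s) (hh : HasDerivAt h h' s) :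
    HasDerivAt (fun t => triple (f t) (g t) (h t))
      (triple f' (g s) (h s) + triple (f s) g' (h s) + triple (f s) (g s) h') s := by
  have h1 : HasDerivAt (fun t => cross (g t) (h t)) (cross (g s) h' + cross g' (h s)) s :=
    crossL.hasDerivAt_of_bilinear (fun _ => hg) (fun _ => hh)
  refine (hf.inner ℝ h1).congr_deriv ?_
  rw [inner_add_right]
  simp only [triple]
  ring

lemma inner_deriv_eq_zero_of_norm_eq {a : ℝ} {f : ℝ → E3} {f' : E3} {s : ℝ}
    (hf : HasDerivAt f f' s) (hn : ∀ t, ‖f t‖ = a) : inner ℝ (f s) f' = 0 := by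
  have h1 := hf.inner ℝ hf
  have h2 : (fun t => (inner ℝ (f t) (f t) : ℝ)) = fun _ => a ^ 2 := by
    ext t; rw [real_inner_self_eq_norm_sq, hn]
  rw [h2] at h1
  have h3 := h1.unique (hasDerivAt_const s (a ^ 2))
  rw [real_inner_comm (f s) f'] at h3
  linarith

lemma inner_sphereDeriv_eq_zero_of_norm_eq {a : ℝ} {φ : S2 → E3} (hφ : SmoothS2 φ)
    (hn : ∀ x, ‖φ x‖ = a) (x : S2) (u : E3) : inner ℝ (φ x) (sphereDeriv φ x u) = 0 := by
  have h1 := sphereDeriv_inner hφ hφ x u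
  have h2 : (fun x => (inner ℝ (φ x) (φ x) : ℝ)) = fun _ => a ^ 2 := by
    ext t; rw [real_inner_self_eq_norm_sq, hn]
  rw [h2] at h1
  have h3 : sphereDeriv (fun _ : S2 => a ^ 2) x u = 0 := by simp [sphereDeriv]
  rw [h3, real_inner_comm (φ x) (sphereDeriv φ x u)] at h1
  linarith

/-- The variation of the pulled-back volume form is exact. -/
theorem hasDerivAt_volForm {a : ℝ} (ha : 0 < a) {φ : ℝ → S2 → E3} (hφ : SmoothFamilyS2 φ)
    (hn : ∀ s x, ‖φ s x‖ = a) (s : ℝ) (x : S2) {u w : E3} (hu : IsTangentAt x u)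
    (hw : IsTangentAt x w) :
    HasDerivAt (fun s => volForm (φ s) x u w)
      (sphereExtDeriv (variationForm (φ s) (fun x => deriv (fun t => φ t x) s)) x u w) s := by
  have hs := hφ.smoothS2 s
  have h := hasDerivAt_triple (hφ.hasDerivAt s x) (hφ.hasDerivAt_sphereDeriv s x u)
    (hφ.hasDerivAt_sphereDeriv s x w)
  refine h.congr_deriv ?_
  rw [sphereExtDeriv_variationForm hs (hφ.smoothS2_deriv s) x hu hw]
  have hne : φ s x ≠ 0 := by
    rw [← norm_ne_zero_iff, hn]; exact ha.ne'
  -- The two sides differ by three times this triple product; all its entries are tangent to the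
  -- sphere of radius `a` at `φ s x`.
  have h0 := triple_eq_zero_of_orthogonal hne
    (inner_deriv_eq_zero_of_norm_eq (hφ.hasDerivAt s x) (fun t => hn t x))
    (inner_sphereDeriv_eq_zero_of_norm_eq hs (hn s) x u)
    (inner_sphereDeriv_eq_zero_of_norm_eq hs (hn s) x w)
  linear_combination 3 * h0

/-! ### Parity -/

lemma sphereExtDeriv_add {α β : S2 → E3} (hα : SmoothS2 α) (hβ : SmoothS2 β) (x : S2) (u w : E3) :
    sphereExtDeriv (fun x => α x + β x) x u w
      = sphereExtDeriv α x u w + sphereExtDeriv β x u w := by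
  simp only [sphereExtDeriv, sphereDeriv_add hα hβ, inner_add_left]
  ring

lemma sphereExtDeriv_sub {α β : S2 → E3} (hα : SmoothS2 α) (hβ : SmoothS2 β) (x : S2) (u w : E3) :
    sphereExtDeriv (fun x => α x - β x) x u w
      = sphereExtDeriv α x u w - sphereExtDeriv β x u w := by
  simp only [sphereExtDeriv, sphereDeriv_sub hα hβ, inner_sub_left]
  ring

lemma sphereExtDeriv_const_smul {α : S2 → E3} (hα : SmoothS2 α) (k : ℝ) (x : S2) (u w : E3) :
    sphereExtDeriv (fun x => k • α x) x u w = k * sphereExtDeriv α x u w := by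
  simp only [sphereExtDeriv, sphereDeriv_const_smul hα, real_inner_smul_left]
  ring

/-- The vectors `u`, `w` are kept fixed, so the chain rule contributes a single sign: Cartesian
components change parity under exterior differentiation. -/
lemma sphereExtDeriv_neg_arg (α : S2 → E3) (x : S2) (u w : E3) :
    sphereExtDeriv (fun x => α (-x)) x u w = - sphereExtDeriv α (-x) u w := by
  simp only [sphereExtDeriv, sphereDeriv_neg_arg, inner_neg_left]
  ring

lemma smoothS2_sphereGrad {f : S2 → ℝ} (hf : SmoothS2 f) : SmoothS2 (sphereGrad f) :=
  SmoothS2.toLp fun j => hf.sphereDeriv (basisVec j)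

lemma inner_sphereGrad (f : S2 → ℝ) (x : S2) (w : E3) :
    inner ℝ (sphereGrad f x) w = sphereDeriv f x w := by
  rw [sphereDeriv_eq_sum f x w, inner_E3]
  simp [sphereGrad]
  ring

lemma isClosedForm_sphereGrad {f : S2 → ℝ} (hf : SmoothS2 f) : IsClosedForm (sphereGrad f) := by
  intro x u w hu hw
  rw [sphereExtDeriv, inner_sphereDeriv (smoothS2_sphereGrad hf),
    inner_sphereDeriv (smoothS2_sphereGrad hf)]
  simp only [inner_sphereGrad]
  rw [sphereDeriv_comm hf hu hw, sub_self]

lemma isTangentAt_neg {x : S2} {u : E3} (hu : IsTangentAt x u) : IsTangentAt (-x) u := by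
  unfold IsTangentAt at *
  rw [coe_neg_sphere, inner_neg_left, hu, neg_zero]

/-- The two signs cancel, so oddness of the two-form is oddness of its Cartesian components. -/
lemma volForm_neg_neg (φ : S2 → E3) (x : S2) (u w : E3) :
    volForm φ x (-u) (-w) = volForm φ x u w := by
  simp only [volForm_eq_triple, sphereDeriv, map_neg, triple_eq, PiLp.neg_apply]
  ring

/-- The parity conditions determine the parity of the field strength. -/
lemma ParityConditions.extDeriv_neg {e a : ℝ} {m : ℤ} {d : AsymptoticData}
    (h : ParityConditions e a m d) {x : S2} {u w : E3} (hu : IsTangentAt x u)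
    (hw : IsTangentAt x w) :
    sphereExtDeriv (d.Aang 0) (-x) u w - (e * a ^ 4)⁻¹ * volForm d.phiInf (-x) u w
      = -(sphereExtDeriv (d.Aang 0) x u w - (e * a ^ 4)⁻¹ * volForm d.phiInf x u w) := by
  obtain ⟨Aeven, Φ, Agau, φ', hAe, hAe', hΦ, -, -, hodd, hAg, hgau, hA⟩ := h.Aang_eq
  have hA' : d.Aang 0 = fun x => Aeven x + sphereGrad Φ x + Agau x := funext hA
  -- The gradient is closed, and `Vol` of `phiInf` enters only through the gauge form; subtracting
  -- it leaves the even one-form and `φ'`, whose contributions are both odd.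
  have hsplit : ∀ x, IsTangentAt x u → IsTangentAt x w → sphereExtDeriv (d.Aang 0) x u w
      = sphereExtDeriv Aeven x u w
        + (e * a ^ 4)⁻¹ * (volForm d.phiInf x u w - volForm φ' x u w) := by
    intro x hu hw
    rw [hA', sphereExtDeriv_add (hAe.1.add (smoothS2_sphereGrad hΦ)) hAg.1,
      sphereExtDeriv_add hAe.1 (smoothS2_sphereGrad hΦ), isClosedForm_sphereGrad hΦ x u w hu hw,
      hgau x u w hu hw, add_zero]
  have heven : sphereExtDeriv Aeven (-x) u w = - sphereExtDeriv Aeven x u w := by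
    have := sphereExtDeriv_neg_arg Aeven x u w
    simp only [hAe'] at this
    have h2 : (fun x => Aeven x) = Aeven := rfl
    rw [h2] at this
    linarith
  have hvol := hodd x u w hu hw
  rw [volForm_neg_neg] at hvol
  rw [hsplit x hu hw, hsplit (-x) (isTangentAt_neg hu) (isTangentAt_neg hw), heven, hvol]
  ring

/-- An odd vector field without divergence is orthogonal to every one-form whose exterior
derivative is odd. -/
theorem integral_inner_eq_zero_of_parity {X α : S2 → E3} (hX : IsTangentField X)
    (hdiv : ∀ x, sphereDiv X x = 0) (hodd : ∀ x, X (-x) = -X x) (hα : IsTangentField α)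
    (hext : ∀ x u w, IsTangentAt x u → IsTangentAt x w →
      sphereExtDeriv α (-x) u w = - sphereExtDeriv α x u w) :
    ∫ x, inner ℝ (X x) (α x) ∂area = 0 := by
  have hneg : SmoothS2 (fun x => α (-x)) := hα.1.neg_arg
  have hnegT : IsTangentField (fun x => α (-x)) := ⟨hneg, fun x => by
    have h := isTangentAt_neg (hα.2 (-x))
    rwa [neg_neg] at h⟩
  have hT := hα.sub hnegT
  -- The derivative of `α(-x)` carries a sign, so oddness of `dα` makes the two terms cancel.
  have hcl : IsClosedForm (fun x => α x - α (-x)) := by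
    intro x u w hu hw
    rw [sphereExtDeriv_sub hα.1 hneg, sphereExtDeriv_neg_arg, hext x u w hu hw]
    ring
  have h := integral_inner_closed_eq_zero hX hdiv hT hcl
  simp only [inner_sub_right] at h
  rw [integral_sub (hX.1.inner hα.1).integrable (hX.1.inner hneg).integrable] at h
  -- Under `x ↦ -x` the pairing of the odd `X` with `α(-x)` becomes minus its pairing with `α`; the
  -- vanishing integral is thus twice the one in question.
  have h2 := integral_comp_neg (fun x => inner ℝ (X x) (α (-x)))
  simp only [neg_neg, hodd, inner_neg_left, integral_neg] at h2
  linarith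

/-- The angular part of the leading coefficient of the symplectic potential integrates to zero. -/
theorem integral_angular_eq_zero {e a : ℝ} (ha : 0 < a) {m : ℤ} {γ : ℝ → Fields}
    {d : ℝ → AsymptoticData} (hγ : IsProtoCurve e a γ d) (hd : ∀ s, ParityConditions e a m (d s)) :
    ∫ x, inner ℝ ((d 0).momang 0 x) (deriv (fun s => (d s).Aang 0 x) 0
      - (e * a ^ 4)⁻¹ • variationForm (d 0).phiInf (fun x => deriv (fun s => (d s).phiInf x) 0) x)
      ∂area = 0 := by
  have hA := hγ.smooth_Aang 0
  have hφ := hγ.smooth_phiInf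
  have hv := isTangentField_variationForm (hφ.smoothS2 0) (hφ.smoothS2_deriv 0)
  have hdA : IsTangentField (fun x => deriv (fun s => (d s).Aang 0 x) 0) := by
    refine ⟨hA.smoothS2_deriv 0, fun x => ?_⟩
    have h1 := (hasDerivAt_const (0 : ℝ) (x : E3)).inner ℝ (hA.hasDerivAt 0 x)
    have h2 : (fun s => (inner ℝ (x : E3) ((d s).Aang 0 x) : ℝ)) = fun _ => 0 := by
      ext s; exact hγ.tangent_Aang s 0 x
    rw [h2] at h1
    have h3 := h1.unique (hasDerivAt_const (0 : ℝ) (0 : ℝ))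
    simpa [IsTangentAt] using h3
  have hα := hdA.sub (hv.const_smul (e * a ^ 4)⁻¹)
  refine integral_inner_eq_zero_of_parity
    ⟨(hγ.smooth_momang 0).smoothS2 0, hγ.tangent_momang 0 0⟩ (hγ.gauss 0) (hd 0).momang_odd hα ?_
  -- The oddness of `dĀ - (e a⁴)⁻¹ Vol_φ` holds at every `s` and so passes to the `s`-derivative.
  -- The fields in the decomposition of `Ā` may therefore depend on `s` in any manner; they are
  -- never differentiated in `s`.
  have hderiv : ∀ x u w, IsTangentAt x u → IsTangentAt x w →
      HasDerivAt (fun s => sphereExtDeriv ((d s).Aang 0) x u w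
        - (e * a ^ 4)⁻¹ * volForm (d s).phiInf x u w)
      (sphereExtDeriv (fun x => deriv (fun s => (d s).Aang 0 x) 0
        - (e * a ^ 4)⁻¹ • variationForm (d 0).phiInf
          (fun x => deriv (fun s => (d s).phiInf x) 0) x) x u w) 0 := by
    intro x u w hu hw
    rw [sphereExtDeriv_sub hdA.1 (hv.const_smul _).1, sphereExtDeriv_const_smul hv.1]
    refine HasDerivAt.sub ?_ ((hasDerivAt_volForm ha hφ hγ.norm_phiInf 0 x hu hw).const_mul _)
    have h1 := ((hA.hasDerivAt_sphereDeriv 0 x u).inner ℝ (hasDerivAt_const (0 : ℝ) w)).sub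
      ((hA.hasDerivAt_sphereDeriv 0 x w).inner ℝ (hasDerivAt_const (0 : ℝ) u))
    refine h1.congr_deriv ?_
    simp [sphereExtDeriv]
  intro x u w hu hw
  have h1 := hderiv (-x) u w (isTangentAt_neg hu) (isTangentAt_neg hw)
  have h2 := (hderiv x u w hu hw).neg
  refine h1.unique (h2.congr_of_eventuallyEq (Eventually.of_forall fun s => ?_))
  exact (hd s).extDeriv_neg hu hw

/-! ### The leading coefficient of the symplectic potential -/

lemma SmoothFamilyS2.sphereDeriv {F : Type*} [NormedAddCommGroup F] [NormedSpace ℝ F]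
    {c : ℝ → S2 → F} (hc : SmoothFamilyS2 c) (u : E3) :
    SmoothFamilyS2 (fun s x => sphereDeriv (c s) x u) := by
  have h : ContDiffOn ℝ ∞ (fun p : ℝ × E3 => ‖p.2‖ •
      fderiv ℝ (fun p : ℝ × E3 => c p.1 (dir p.2)) p (0, u)) (Set.univ ×ˢ {0}ᶜ) := by
    refine ContDiffOn.fun_smul ?_ ?_
    · intro p hp
      exact ((contDiffAt_norm ℝ hp.2).comp p contDiffAt_snd).contDiffWithinAt
    · exact (ContDiffOn.fderiv_of_isOpen hc isOpen_familyDomain (by simp)).clm_apply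
        contDiffOn_const
  refine h.congr fun p hp => ?_
  simp only
  rw [sphereDeriv_dir _ hp.2, hc.fderiv_slice p.1 hp.2]

lemma SmoothFamilyS2.smul {F : Type*} [NormedAddCommGroup F] [NormedSpace ℝ F]
    {f : ℝ → S2 → ℝ} {c : ℝ → S2 → F} (hf : SmoothFamilyS2 f) (hc : SmoothFamilyS2 c) :
    SmoothFamilyS2 (fun s x => f s x • c s x) := ContDiffOn.smul hf hc

lemma SmoothFamilyS2.apply {c : ℝ → S2 → E3} (hc : SmoothFamilyS2 c) (i : Fin 3) :
    SmoothFamilyS2 (fun s x => c s x i) := (coordL i).contDiff.comp_contDiffOn hc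

lemma SmoothFamilyS2.cross {c c' : ℝ → S2 → E3} (hc : SmoothFamilyS2 c)
    (hc' : SmoothFamilyS2 c') : SmoothFamilyS2 (fun s x => cross (c s x) (c' s x)) :=
  (crossL.contDiff.comp_contDiffOn hc).clm_apply hc'

section Coefficients

variable {e a : ℝ} {γ : ℝ → Fields} {d : ℝ → AsymptoticData}

lemma IsProtoCurve.smooth_coeffAr (h : IsProtoCurve e a γ d) (n : ℕ) :
    SmoothFamilyS2 (fun s => coeffAr (d s) n) := (h.smooth_Ar n).smul h.smooth_phiInf

lemma IsProtoCurve.smooth_coeffMomr (h : IsProtoCurve e a γ d) (n : ℕ) :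
    SmoothFamilyS2 (fun s => coeffMomr (d s) n) := (h.smooth_momr n).smul h.smooth_phiInf

lemma IsProtoCurve.smooth_coeffMomang (h : IsProtoCurve e a γ d) (j : Fin 3) (n : ℕ) :
    SmoothFamilyS2 (fun s => coeffMomang (d s) j n) :=
  ((h.smooth_momang n).apply j).smul h.smooth_phiInf

lemma IsProtoCurve.smooth_coeffAang (h : IsProtoCurve e a γ d) (j : Fin 3) (n : ℕ) :
    SmoothFamilyS2 (fun s => coeffAang e a (d s) j n) := by
  have h1 : SmoothFamilyS2 (fun s x => (d s).Aang n x j • (d s).phiInf x) :=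
    ((h.smooth_Aang n).apply j).smul h.smooth_phiInf
  have h2 : SmoothFamilyS2 (fun s x => if n = 0 then
      -((e * a ^ 2)⁻¹ • _root_.cross ((d s).phiInf x) (sphereDeriv (d s).phiInf x (basisVec j)))
      else (0 : E3)) := by
    by_cases hn : n = 0
    · simp only [hn, if_true]
      exact ContDiffOn.neg (ContDiffOn.const_smul _
        (h.smooth_phiInf.cross (h.smooth_phiInf.sphereDeriv (basisVec j))))
    · simp only [hn, if_false]
      exact contDiffOn_const
  exact ContDiffOn.add h2 h1

/-- As `phiInf` has constant length, its variation is orthogonal to it and only the scalar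
coefficient contributes. -/
lemma inner_coeff_radial (h : IsProtoCurve e a γ d) (x : S2) :
    inner ℝ (coeffMomr (d 0) 0 x) (deriv (fun t => coeffAr (d t) 0 x) 0)
      = a ^ 2 * ((d 0).momr 0 x * deriv (fun t => (d t).Ar 0 x) 0) := by
  have hφ := h.smooth_phiInf.hasDerivAt 0 x
  have hd := ((h.smooth_Ar 0).hasDerivAt 0 x).fun_smul hφ
  have h0 := inner_deriv_eq_zero_of_norm_eq hφ (fun t => h.norm_phiInf t x)
  simp only [coeffAr, coeffMomr]
  rw [hd.deriv, inner_add_right, inner_smul_right, inner_smul_right, real_inner_smul_left,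
    real_inner_smul_left, h0, real_inner_self_eq_norm_sq, h.norm_phiInf]
  ring

/-- The momentum is parallel to `φ = phiInf`. Of the variation of `φ × ∂φ` only `∂_s φ × ∂φ` has a
component along `φ`, and this yields `variationForm`; extracting `a²` turns `(e a²)⁻¹` into `(e
a⁴)⁻¹`. -/
lemma inner_coeff_angular (ha : 0 < a) (h : IsProtoCurve e a γ d) (j : Fin 3) (x : S2) :
    inner ℝ (coeffMomang (d 0) j 0 x) (deriv (fun t => coeffAang e a (d t) j 0 x) 0)
      = a ^ 2 * ((d 0).momang 0 x j * (deriv (fun s => (d s).Aang 0 x) 0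
      - (e * a ^ 4)⁻¹ • variationForm (d 0).phiInf
        (fun x => deriv (fun s => (d s).phiInf x) 0) x) j) := by
  have hφ := h.smooth_phiInf.hasDerivAt 0 x
  have hD := h.smooth_phiInf.hasDerivAt_sphereDeriv 0 x (basisVec j)
  have hA : HasDerivAt (fun t => (d t).Aang 0 x j) (deriv (fun s => (d s).Aang 0 x) 0 j) 0 :=
    (coordL j).hasFDerivAt.comp_hasDerivAt (0 : ℝ) ((h.smooth_Aang 0).hasDerivAt 0 x)
  have hc : HasDerivAt (fun t => cross ((d t).phiInf x) (sphereDeriv (d t).phiInf x (basisVec j)))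
      _ 0 := crossL.hasDerivAt_of_bilinear (fun _ => hφ) (fun _ => hD)
  have hd : HasDerivAt (fun t => coeffAang e a (d t) j 0 x) _ 0 :=
    ((hc.fun_const_smul (e * a ^ 2)⁻¹).fun_neg).fun_add (hA.fun_smul hφ)
  have h0 := inner_deriv_eq_zero_of_norm_eq hφ (fun t => h.norm_phiInf t x)
  have h1 := real_inner_self_eq_norm_sq ((d 0).phiInf x)
  rw [h.norm_phiInf] at h1
  have h2 : ∀ v : E3, inner ℝ ((d 0).phiInf x) (crossL ((d 0).phiInf x) v) = 0 := by
    intro v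
    rw [crossL_apply, inner_E3]
    simp
    ring
  have h3 : ∀ v w : E3, inner ℝ ((d 0).phiInf x) (crossL v w) = triple ((d 0).phiInf x) v w :=
    fun v w => rfl
  have hk : (e * a ^ 2)⁻¹ = a ^ 2 * (e * a ^ 4)⁻¹ := by
    have := ha.ne'
    rw [mul_inv, mul_inv]
    field_simp
  rw [hd.deriv, coeffMomang, real_inner_smul_left, inner_add_right, inner_neg_right,
    inner_smul_right, inner_add_right, h2, h3, inner_add_right, inner_smul_right, inner_smul_right,
    h0, h1, hk]
  simp only [variationForm, PiLp.sub_apply, PiLp.smul_apply, smul_eq_mul]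
  ring

/-- The coefficient of `r⁻³` in the integrand of the symplectic potential. -/
def leadingDensity (e a : ℝ) (d : ℝ → AsymptoticData) (x : S2) : ℝ :=
  inner ℝ (coeffMomr (d 0) 0 x) (deriv (fun t => coeffAr (d t) 0 x) 0)
    + ∑ j, inner ℝ (coeffMomang (d 0) j 0 x) (deriv (fun t => coeffAang e a (d t) j 0 x) 0)

lemma IsProtoCurve.smooth_leadingDensity (h : IsProtoCurve e a γ d) :
    SmoothS2 (leadingDensity e a d) :=
  (((h.smooth_coeffMomr 0).smoothS2 0).inner ((h.smooth_coeffAr 0).smoothS2_deriv 0)).add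
    (SmoothS2.sum fun j _ => ((h.smooth_coeffMomang j 0).smoothS2 0).inner
      ((h.smooth_coeffAang j 0).smoothS2_deriv 0))

/-- The logarithmically divergent contribution vanishes by parity. -/
theorem integral_leadingDensity (ha : 0 < a) {m : ℤ} (h : IsProtoCurve e a γ d)
    (hd : ∀ s, ParityConditions e a m (d s)) : ∫ x, leadingDensity e a d x ∂area = 0 := by
  have hr : SmoothS2 (fun x => inner ℝ (coeffMomr (d 0) 0 x)
      (deriv (fun t => coeffAr (d t) 0 x) 0)) :=
    ((h.smooth_coeffMomr 0).smoothS2 0).inner ((h.smooth_coeffAr 0).smoothS2_deriv 0)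
  have hang : SmoothS2 (fun x => ∑ j, inner ℝ (coeffMomang (d 0) j 0 x)
      (deriv (fun t => coeffAang e a (d t) j 0 x) 0)) :=
    SmoothS2.sum fun j _ => ((h.smooth_coeffMomang j 0).smoothS2 0).inner
      ((h.smooth_coeffAang j 0).smoothS2_deriv 0)
  simp only [leadingDensity]
  rw [integral_add hr.integrable hang.integrable]
  have h1 : ∫ x, inner ℝ (coeffMomr (d 0) 0 x) (deriv (fun t => coeffAr (d t) 0 x) 0) ∂area
      = 0 := by
    refine integral_eq_zero_of_odd fun x => ?_
    rw [inner_coeff_radial h, inner_coeff_radial h, (hd 0).momr_even]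
    have : (fun t => (d t).Ar 0 (-x)) = fun t => - (d t).Ar 0 x := by
      ext t; exact (hd t).Ar_odd x
    rw [this, deriv.fun_neg]
    ring
  have h2 := integral_angular_eq_zero ha h hd
  rw [h1, zero_add]
  simp only [inner_coeff_angular ha h]
  simp only [← Finset.mul_sum]
  rw [integral_const_mul, mul_eq_zero]
  right
  refine Eq.trans ?_ h2
  congr 1 with x
  rw [inner_E3, Fin.sum_univ_three]

end Coefficients

/-! ### Asymptotic expansions and integrability -/

lemma isBigO_one_of_continuous {c : S2 → E3} (hc : Continuous c) :
    (fun x : E3 => c (dir x)) =O[cocompact E3] (fun _ => (1 : ℝ)) := by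
  obtain ⟨C, hC⟩ := isCompact_univ.exists_bound_of_continuousOn hc.continuousOn
  exact Asymptotics.isBigO_of_le' (c := C) _ fun x => by
    simpa using hC (dir x) (Set.mem_univ _)

lemma inv_norm_isBigO_one : (fun x : E3 => ‖x‖⁻¹) =O[cocompact E3] (fun _ => (1 : ℝ)) := by
  refine Asymptotics.IsBigO.of_bound 1 ?_
  filter_upwards [tendsto_norm_cocompact_atTop.eventually_ge_atTop 1] with x hx
  simp only [norm_inv, norm_norm, norm_one, mul_one]
  exact inv_le_one_of_one_le₀ hx

lemma HasExpansion.sub_isBigO {f : E3 → E3} {c : ℕ → S2 → E3} (hf : HasExpansion f c)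
    (hc : Continuous (c 1)) :
    (fun x => f x - c 0 (dir x)) =O[cocompact E3] (fun x => ‖x‖⁻¹) := by
  -- The expansion is used to order one: its error is `o(r⁻¹)`, and the coefficient of `r⁻¹` is
  -- bounded on the compact sphere.
  have h1 := (hf 1).isBigO
  simp only [Finset.sum_range_succ, Finset.range_zero, Finset.sum_empty, pow_zero, one_smul,
    pow_one, zero_add] at h1
  have h2 : (fun x : E3 => ‖x‖⁻¹ • c 1 (dir x)) =O[cocompact E3] (fun x => ‖x‖⁻¹ • (1 : ℝ)) :=
    (Asymptotics.isBigO_refl _ _).smul (isBigO_one_of_continuous hc)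
  simp only [smul_eq_mul, mul_one] at h2
  refine (h1.add h2).congr_left fun x => ?_
  abel

lemma HasExpansion.isBigO_one {f : E3 → E3} {c : ℕ → S2 → E3} (hf : HasExpansion f c)
    (h0 : Continuous (c 0)) (h1 : Continuous (c 1)) :
    f =O[cocompact E3] (fun _ => (1 : ℝ)) := by
  refine (((hf.sub_isBigO h1).trans inv_norm_isBigO_one).add
    (isBigO_one_of_continuous h0)).congr_left fun x => ?_
  abel

lemma isBigO_inner {f g : E3 → E3} {p q : E3 → ℝ} (hf : f =O[cocompact E3] p)
    (hg : g =O[cocompact E3] q) :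
    (fun x => (inner ℝ (f x) (g x) : ℝ)) =O[cocompact E3] (fun x => p x * q x) :=
  (Asymptotics.isBigO_of_le _ fun x => by
    rw [norm_mul, norm_norm, norm_norm]
    exact norm_inner_le_norm (f x) (g x)).trans (hf.norm_left.mul hg.norm_left)

/-- The leading behaviour of the scalar product of two expansions. -/
lemma HasExpansion.inner_sub_isBigO {f g : E3 → E3} {c c' : ℕ → S2 → E3} (hf : HasExpansion f c)
    (hg : HasExpansion g c') (h0 : Continuous (c 0)) (h1 : Continuous (c 1))
    (h0' : Continuous (c' 0)) (h1' : Continuous (c' 1)) :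
    (fun x => inner ℝ (f x) (g x) - inner ℝ (c 0 (dir x)) (c' 0 (dir x)))
      =O[cocompact E3] (fun x => ‖x‖⁻¹) := by
  -- The difference splits as `⟨f - c, g⟩ + ⟨c, g - c'⟩`, in each of which one factor is bounded and
  -- the other is `O(r⁻¹)`.
  have hA := isBigO_inner (hf.sub_isBigO h1) (hg.isBigO_one h0' h1')
  have hB := isBigO_inner (isBigO_one_of_continuous h0) (hg.sub_isBigO h1')
  simp only [mul_one, one_mul] at hA hB
  refine (hA.add hB).congr_left fun x => ?_
  rw [inner_sub_left, inner_sub_right]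
  ring

/-- Locally integrable functions that decay like `r⁻⁴` are integrable. -/
lemma integrable_of_isBigO_inv_pow_four {f : E3 → ℝ} (hf : LocallyIntegrable f)
    (ho : f =O[cocompact E3] (fun x => ‖x‖⁻¹ ^ 4)) : Integrable f := by
  have hint : Integrable (fun x : E3 => (1 + ‖x‖) ^ (-(4 : ℝ))) :=
    integrable_one_add_norm (by simp; norm_num)
  refine hf.integrable_of_isBigO_cocompact (ho.trans ?_) (hint.integrableAtFilter _)
  -- The constant is `2⁴`, from `1 + ‖x‖ ≤ 2‖x‖` for `‖x‖ ≥ 1`.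
  refine Asymptotics.IsBigO.of_bound 16 ?_
  filter_upwards [tendsto_norm_cocompact_atTop.eventually_ge_atTop 1] with x hx
  have hpos : 0 < 1 + ‖x‖ := by positivity
  have h1 : (1 + ‖x‖) ^ (-(4 : ℝ)) = ((1 + ‖x‖) ^ 4)⁻¹ := by
    rw [Real.rpow_neg hpos.le, ← Real.rpow_natCast]
    norm_num
  rw [h1, Real.norm_of_nonneg (by positivity), Real.norm_of_nonneg (by positivity)]
  have h2 : (1 + ‖x‖) ^ 4 ≤ (2 * ‖x‖) ^ 4 := by gcongr; linarith
  have h3 : 0 < ‖x‖ := by linarith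
  rw [inv_pow, ← div_eq_mul_inv, ← one_div, div_le_div_iff₀ (by positivity) (by positivity)]
  calc 1 * (1 + ‖x‖) ^ 4 ≤ (2 * ‖x‖) ^ 4 := by rw [one_mul]; exact h2
    _ = 16 * ‖x‖ ^ 4 := by ring

/-- The radial profile of the tail `r⁻³`. -/
def tailProfile (r : ℝ) : ℝ := if 1 ≤ r then r⁻¹ ^ 3 else 0

lemma measurable_tailProfile : Measurable tailProfile :=
  Measurable.ite measurableSet_Ici (by fun_prop) measurable_const

lemma locallyIntegrable_tail {c : S2 → ℝ} (hc : Continuous c) :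
    LocallyIntegrable (fun x : E3 => tailProfile ‖x‖ * c (dir x)) := by
  obtain ⟨C, hC⟩ := isCompact_univ.exists_bound_of_continuousOn hc.continuousOn
  refine (locallyIntegrable_const (C : ℝ)).mono ?_ (Eventually.of_forall fun x => ?_)
  · exact ((measurable_tailProfile.comp measurable_norm).mul
      (hc.measurable.comp measurable_dir)).aestronglyMeasurable
  · have h1 : ‖tailProfile ‖x‖‖ ≤ 1 := by
      rw [tailProfile]
      split_ifs with h
      · rw [Real.norm_of_nonneg (by positivity)]
        exact pow_le_one₀ (by positivity) (inv_le_one_of_one_le₀ h)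
      · simp
    rw [norm_mul]
    calc ‖tailProfile ‖x‖‖ * ‖c (dir x)‖ ≤ 1 * ‖c (dir x)‖ := by gcongr
      _ ≤ C := by rw [one_mul]; exact hC _ (Set.mem_univ _)
      _ ≤ ‖C‖ := Real.le_norm_self C

/-- In polar coordinates the angular mean factors out, so the integral vanishes at every radius and
not only in the limit. -/
lemma setIntegral_ball_tail {c : S2 → ℝ} (hc : ∫ x, c x ∂area = 0) (R : ℝ) :
    ∫ x in Metric.ball (0 : E3) R, tailProfile ‖x‖ * c (dir x) = 0 := by
  rw [← integral_indicator measurableSet_ball]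
  have h := integral_radial_mul_angular (fun r => if r < R then tailProfile r else 0) c
  rw [hc, zero_mul] at h
  rw [← h]
  congr 1 with x
  by_cases hx : ‖x‖ < R
  · simp [Set.indicator, hx]
  · simp [Set.indicator, hx]

/-- Functions with expansion `r⁻³ c + O(r⁻⁴)`, where `c` has mean zero, have an improper integral
over balls. -/
theorem tendsto_setIntegral_ball {g : E3 → ℝ} (hg : Continuous g) {c : S2 → ℝ}
    (hc : Continuous c) (h0 : ∫ x, c x ∂area = 0)
    (ho : (fun x => ‖x‖ ^ 3 * g x - c (dir x)) =O[cocompact E3] (fun x => ‖x‖⁻¹)) :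
    ∃ L : ℝ, Tendsto (fun R : ℝ => ∫ x in Metric.ball (0 : E3) R, g x) atTop (𝓝 L) := by
  have hloc := hg.locallyIntegrable (μ := (volume : Measure E3))
  have hloc' := locallyIntegrable_tail hc
  -- Removing the tail leaves `O(r⁻⁴)`, which is absolutely integrable, without changing the
  -- integral over any ball.
  have hint : Integrable (fun x => g x - tailProfile ‖x‖ * c (dir x)) := by
    refine integrable_of_isBigO_inv_pow_four (hloc.sub hloc') ?_
    have h1 := (Asymptotics.isBigO_refl (fun x : E3 => ‖x‖⁻¹ ^ 3) (cocompact E3)).mul ho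
    refine h1.congr' ?_ (Eventually.of_forall fun x => by ring)
    filter_upwards [tendsto_norm_cocompact_atTop.eventually_ge_atTop 1] with x hx
    have h3 : ‖x‖ ≠ 0 := by linarith
    rw [tailProfile, if_pos hx]
    field_simp
  refine ⟨∫ x, (g x - tailProfile ‖x‖ * c (dir x)), ?_⟩
  have ht := (aecover_ball (μ := (volume : Measure E3)) (x := 0)
    (tendsto_id (α := ℝ) (x := atTop))).integral_tendsto_of_countably_generated hint
  refine ht.congr fun R => ?_
  have hi : ∀ {f : E3 → ℝ}, LocallyIntegrable f → IntegrableOn f (Metric.ball (0 : E3) R) :=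
    fun hf => (hf.integrableOn_isCompact (isCompact_closedBall (0 : E3) R)).mono_set
      Metric.ball_subset_closedBall
  rw [id, integral_sub (hi hloc) (hi hloc'), setIntegral_ball_tail h0, sub_zero]

/-! ### Finiteness of the symplectic potential -/

lemma hasDerivAt_slice {f : ℝ → E3 → E3} (hf : ContDiff ℝ ∞ (fun p : ℝ × E3 => f p.1 p.2))
    (s : ℝ) (x : E3) :
    HasDerivAt (fun t => f t x) (fderiv ℝ (fun p : ℝ × E3 => f p.1 p.2) (s, x) (1, 0)) s :=
  HasFDerivAt.comp_hasDerivAt (f := fun t : ℝ => (t, x)) s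
    (hf.differentiable (by simp) (s, x)).hasFDerivAt
    ((hasDerivAt_id s).prodMk (hasDerivAt_const s x))

lemma hasDerivAt_deriv_slice {f : ℝ → E3 → E3}
    (hf : ContDiff ℝ ∞ (fun p : ℝ × E3 => f p.1 p.2)) (s : ℝ) (x : E3) :
    HasDerivAt (fun t => f t x) (deriv (fun t => f t x) s) s :=
  (hasDerivAt_slice hf s x).differentiableAt.hasDerivAt

lemma continuous_deriv_slice {f : ℝ → E3 → E3}
    (hf : ContDiff ℝ ∞ (fun p : ℝ × E3 => f p.1 p.2)) (s : ℝ) :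
    Continuous (fun x => deriv (fun t => f t x) s) := by
  have h : (fun x => deriv (fun t => f t x) s)
      = fun x => fderiv ℝ (fun p : ℝ × E3 => f p.1 p.2) (s, x) (1, 0) := by
    ext1 x
    exact (hasDerivAt_slice hf s x).deriv
  rw [h]
  exact ((hf.continuous_fderiv (by simp)).comp (by fun_prop : Continuous fun x : E3 =>
    (s, x))).clm_apply continuous_const

/-- The decomposition into radial and angular parts is orthogonal because the direction has unit
length. -/
lemma sum_inner_eq_radial_add_angular (P Q : Fin 3 → E3 → E3) (x : E3) :
    ∑ i, inner ℝ (P i x) (Q i x) = inner ℝ (radialPart P x) (radialPart Q x)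
      + ∑ j, (inner ℝ (angularPart P j x) (angularPart Q j x) : ℝ) := by
  have hn := norm_sq_S2 (dir x)
  set R := radialPart P x with hR
  set S := radialPart Q x with hS
  have h1 : inner ℝ R S = ∑ i, (dir x : E3) i * (inner ℝ (P i x) S : ℝ) := by
    rw [hR, radialPart, sum_inner]
    simp only [real_inner_smul_left]
  have h2 : inner ℝ R S = ∑ i, (dir x : E3) i * (inner ℝ R (Q i x) : ℝ) := by
    rw [hS, radialPart, inner_sum]
    simp only [inner_smul_right]
  simp only [angularPart, ← hR, ← hS, inner_sub_left, inner_sub_right, real_inner_smul_left,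
    inner_smul_right, Fin.sum_univ_three] at h1 h2 ⊢
  linear_combination -h1 - h2 - (inner ℝ R S : ℝ) * hn

section Potential

variable {e a : ℝ} {γ : ℝ → Fields} {d : ℝ → AsymptoticData}

lemma deriv_radialPart (h : IsProtoCurve e a γ d) (x : E3) :
    HasDerivAt (fun t => radialPart (γ t).A x) (radialPart (velocity γ).A x) 0 :=
  HasDerivAt.fun_sum fun i _ =>
    (hasDerivAt_deriv_slice (f := fun t => (γ t).A i) (h.smooth_A i) 0 x).fun_const_smul _

lemma deriv_angularPart (h : IsProtoCurve e a γ d) (j : Fin 3) (x : E3) :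
    HasDerivAt (fun t => angularPart (γ t).A j x) (angularPart (velocity γ).A j x) 0 :=
  (hasDerivAt_deriv_slice (f := fun t => (γ t).A j) (h.smooth_A j) 0 x).fun_sub
    ((deriv_radialPart h x).fun_const_smul _)

/-- The integrand of the symplectic potential up to terms of order `r⁻⁴`. -/
lemma integrand_sub_leadingDensity_isBigO (h : IsProtoCurve e a γ d) :
    (fun x => ‖x‖ ^ 3 * ∑ i, inner ℝ ((γ 0).mom i x) ((velocity γ).A i x)
      - leadingDensity e a d (dir x)) =O[cocompact E3] (fun x => ‖x‖⁻¹) := by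
  have hr := (h.expansion_momr 0).1.inner_sub_isBigO (h.expansion_Ar 0).2
    ((h.smooth_coeffMomr 0).smoothS2 0).continuous ((h.smooth_coeffMomr 1).smoothS2 0).continuous
    ((h.smooth_coeffAr 0).smoothS2_deriv 0).continuous
    ((h.smooth_coeffAr 1).smoothS2_deriv 0).continuous
  have hang : ∀ j, _ := fun j => (h.expansion_momang j 0).1.inner_sub_isBigO
    (h.expansion_Aang j 0).2
    ((h.smooth_coeffMomang j 0).smoothS2 0).continuous
    ((h.smooth_coeffMomang j 1).smoothS2 0).continuous
    ((h.smooth_coeffAang j 0).smoothS2_deriv 0).continuous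
    ((h.smooth_coeffAang j 1).smoothS2_deriv 0).continuous
  refine (((hr.add (hang 0)).add (hang 1)).add (hang 2)).congr_left fun x => ?_
  rw [((deriv_radialPart h x).fun_const_smul ‖x‖).deriv,
    ((deriv_angularPart h 0 x).fun_const_smul ‖x‖).deriv,
    ((deriv_angularPart h 1 x).fun_const_smul ‖x‖).deriv,
    ((deriv_angularPart h 2 x).fun_const_smul ‖x‖).deriv]
  -- The weights `‖x‖²` of the momentum and `‖x‖` of the field combine to `‖x‖³`.
  rw [sum_inner_eq_radial_add_angular, leadingDensity]
  simp only [real_inner_smul_left, inner_smul_right, Fin.sum_univ_three]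
  ring

theorem symplecticPotentialFinite (ha : 0 < a) {m : ℤ} (h : IsProtoCurve e a γ d)
    (hd : ∀ s, ParityConditions e a m (d s)) : SymplecticPotentialFinite (γ 0) (velocity γ) := by
  have hslice : ∀ {f : ℝ → E3 → E3}, ContDiff ℝ ∞ (fun p : ℝ × E3 => f p.1 p.2) →
      Continuous (f 0) := fun hf =>
    hf.continuous.comp (by fun_prop : Continuous fun x : E3 => ((0 : ℝ), x))
  have hcont : Continuous (fun x => ∑ i, (inner ℝ ((γ 0).mom i x) ((velocity γ).A i x) : ℝ)) :=
    continuous_finsetSum _ fun i _ => (hslice (f := fun t => (γ t).mom i) (h.smooth_mom i)).inner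
      (continuous_deriv_slice (f := fun t => (γ t).A i) (h.smooth_A i) 0)
  refine ⟨fun R => ?_, ?_, ?_⟩
  · exact (hcont.locallyIntegrable.integrableOn_isCompact (isCompact_closedBall (0 : E3) R)).mono_set
      Metric.ball_subset_closedBall
  · exact tendsto_setIntegral_ball hcont h.smooth_leadingDensity.continuous
      (integral_leadingDensity ha h hd) (integrand_sub_leadingDensity_isBigO h)
  · have hc : Continuous (fun x => (inner ℝ ((γ 0).phiMom x) ((velocity γ).phi x) : ℝ)) :=
      (hslice (f := fun t => (γ t).phiMom) h.smooth_phiMom).inner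
        (continuous_deriv_slice (f := fun t => (γ t).phi) h.smooth_phi 0)
    refine integrable_of_isBigO_inv_pow_four hc.locallyIntegrable ?_
    -- Order four of the rapid decay suffices, since the variation of the Higgs field is bounded.
    have h1 := ((h.expansion_phiMom 0).1 4).isBigO
    simp only [smul_zero, Finset.sum_const_zero, sub_zero] at h1
    have h2 : (velocity γ).phi =O[cocompact E3] (fun _ => (1 : ℝ)) := by
      refine (h.expansion_phi 0).2.isBigO_one ?_ ?_
      · exact (h.smooth_phiInf.smoothS2_deriv 0).continuous
      · simp only [coeffPhi, one_ne_zero, if_false, deriv_const]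
        exact continuous_const
    have h3 := isBigO_inner h1 h2
    simpa only [mul_one] using h3

end Potential

end

theorem mainTheorem3 (e a : ℝ) (he : e ≠ 0) (ha : 0 < a) (m : ℤ) (hm : m ≠ 0) :
    (∀ φ φ' : S2 → E3, IsVacuum a m φ → IsVacuum a m φ' →
      ∃ Agau : S2 → E3, IsTangentField Agau ∧ IsGaugeForm e a φ φ' Agau) ∧
    (∀ (γ : ℝ → Fields) (d : ℝ → AsymptoticData), IsProtoCurve e a γ d →
      (∀ s, ParityConditions e a m (d s)) →
      SymplecticPotentialFinite (γ 0) (velocity γ)) :=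
  ⟨fun _ _ hφ hφ' => exists_isGaugeForm ha hφ hφ',
    fun _ _ h hd => symplecticPotentialFinite ha h hd⟩
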